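/- Let $P$ be a spherical pentagon on the unit sphere, with vertices $A,B,D,E,C$ in this cyclic order, whose five edges $AB$, $BD$, $DE$, $EC$, $CA$ are great arcs (of lengths in $(0,2\pi)$, possibly greater than $\pi$) and whose boundary is a simple closed curve. The pentagon is either of the two regions bounded by this curve, and $\alpha,\beta,\delta,\epsilon,\gamma\in(0,2\pi)$ denote its interior angles at $A,B,D,E,C$, respectively. Suppose that $AB$ and $AC$ have the same length $b$, and that $BD$ and $CE$ have the same length $a$. Then $\beta>\gamma$ if and only if $\delta<\epsilon$. -/

import Mathlib

open scoped Matrix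

noncomputable section

/-- Euclidean three-space; the sphere is its unit sphere centred at the origin. -/
abbrev Space3 : Type := EuclideanSpace ℝ (Fin 3)

/-- The cross product on Euclidean three-space. -/
def cross3 (x y : Space3) : Space3 := WithLp.toLp 2 (x.ofLp ⨯₃ y.ofLp)

/-- A great arc on the unit sphere: it leaves `start` in the unit tangent direction `dir` and runs
along a great circle for the given length, which is less than a full circle (it may exceed `π`). -/
structure GreatArc where
  start : Space3
  dir : Space3
  length : ℝ
  norm_start : ‖start‖ = 1
  norm_dir : ‖dir‖ = 1
  inner_start_dir : inner ℝ start dir = 0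
  length_pos : 0 < length
  length_lt : length < 2 * Real.pi

namespace GreatArc

/-- Unit speed parametrisation of the arc, on `[0, length]`. -/
def point (e : GreatArc) (t : ℝ) : Space3 := Real.cos t • e.start + Real.sin t • e.dir

/-- The unit tangent vector of the arc at parameter `t`, in the direction of travel. -/
def velocity (e : GreatArc) (t : ℝ) : Space3 := -Real.sin t • e.start + Real.cos t • e.dir

end GreatArc

/-- A closed chain of `n` great arcs on the unit sphere, each one starting where its cyclic
predecessor ends. The `i`-th vertex is the starting point of the `i`-th edge. -/
structure SphericalPolygon (n : ℕ) [NeZero n] where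
  edge : Fin n → GreatArc
  closed : ∀ i : Fin n, (edge i).point (edge i).length = (edge (i + 1)).start

/-- The angle in `[0, 2π)` by which the tangent direction `x` at the point `p` of the unit sphere
has to be rotated about `p`, counterclockwise as seen from outside the sphere, to reach `y`. -/
def ccwAngle (p x y : Space3) : ℝ :=
  toIcoMod Real.two_pi_pos 0 (Complex.arg ⟨inner ℝ x y, inner ℝ p (cross3 x y)⟩)

/-- The two sides of a closed curve on the sphere, as seen from outside the sphere when the curve
is traversed in its given direction. -/
inductive Side where
  | left
  | right

namespace SphericalPolygon

variable {n : ℕ} [NeZero n]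

/-- The boundary is a simple closed curve: traversed once around, it is injective. -/
def IsSimple (P : SphericalPolygon n) : Prop :=
  ∀ i j : Fin n, ∀ s ∈ Set.Ico 0 (P.edge i).length, ∀ t ∈ Set.Ico 0 (P.edge j).length,
    (P.edge i).point s = (P.edge j).point t → i = j ∧ s = t

/-- The length of the `i`-th edge, which joins vertex `i` to vertex `i + 1`. -/
def edgeLength (P : SphericalPolygon n) (i : Fin n) : ℝ := (P.edge i).length

/-- The direction at vertex `i` pointing along the edge to vertex `i + 1`. -/
def dirNext (P : SphericalPolygon n) (i : Fin n) : Space3 := (P.edge i).dir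

/-- The direction at vertex `i` pointing back along the edge to vertex `i - 1`. -/
def dirPrev (P : SphericalPolygon n) (i : Fin n) : Space3 :=
  -(P.edge (i - 1)).velocity (P.edge (i - 1)).length

/-- The angle at vertex `i` of the region bounded by the polygon on the given side. The sector
on the left is swept counterclockwise from the outgoing edge to the incoming one, and the sector
on the right is the remaining one. -/
def interiorAngle (P : SphericalPolygon n) : Side → Fin n → ℝ
  | .left, i => ccwAngle (P.edge i).start (P.dirNext i) (P.dirPrev i)
  | .right, i => ccwAngle (P.edge i).start (P.dirPrev i) (P.dirNext i)

end SphericalPolygon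

end

noncomputable section

namespace SphereRotor

/-! ### Rotor algebra and the pentagon identity -/

open Quaternion Real

/-! Carry a frame (tangent, left normal, position) around the pentagon. Each edge and each turn
rotates the frame about one of its own axes, and after a full circuit the frame returns. Lifted to
unit quaternions, the product of the edge and turn rotors is therefore `1` or `-1`, and for a simple
closed curve it is always `-1` (`pentagon_rotor`).

The equal edges make this relation nearly symmetric. Rotated cyclically so that the turn at A is in
the middle, the chain E, C, A, B, D equals minus the inverse of the remaining piece, which consists
of DE and its two turns. The coefficient of `i` is odd under reversing products of rotors, since
these involve only `1, j, k`. Hence it measures the asymmetry of each side, and `pentagon_identity`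
gives sin b · cos (t₀/2) · sin ((t₁ - t₄)/2) = sin (c/2) · sin ((t₃ - t₂)/2), with c the length of
DE and each tᵢ equal to π minus the left angle at vertex i. Simplicity forces b < π (`length_lt_pi`)
and a nonzero angle at A, so all factors but the two sines of differences are positive. Comparing
their signs is the theorem for the left region; angles on the right are complements to 2π.

The substance is the sign `-1`. For a nondegenerate triangle it comes from comparing `j`
coefficients (`triangle_rotor`). A polygon in general position is reduced to a triangle by cutting
off ears: each cut changes the holonomy by a sign that counts, modulo 2, crossings and points inside
the ear (`ear_rotor`), and these signs are tracked by the crossings of the current diagonal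
(`fanRotor_eq`). A degenerate simple polygon is a limit of polygons in general position whose
nonadjacent edges still do not cross, and the holonomy is continuous as long as no turn reverses
direction (`fanRotor_of_simple`). Edges longer than π are handled by dividing every edge into
thirds. -/

/-- The lift to unit quaternions of the rotation by `l` about the second axis of a moving frame
(tangent, normal, position): travel along a great circle over the distance `l`. -/
def edgeRotor (l : ℝ) : ℍ[ℝ] := ⟨cos (l / 2), 0, sin (l / 2), 0⟩

/-- The lift to unit quaternions of the rotation by `t` about the position vector of a moving
frame. -/
def turnRotor (t : ℝ) : ℍ[ℝ] := ⟨cos (t / 2), 0, 0, sin (t / 2)⟩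

@[simp] theorem edgeRotor_re (l : ℝ) : (edgeRotor l).re = cos (l / 2) := rfl
@[simp] theorem edgeRotor_imI (l : ℝ) : (edgeRotor l).imI = 0 := rfl
@[simp] theorem edgeRotor_imJ (l : ℝ) : (edgeRotor l).imJ = sin (l / 2) := rfl
@[simp] theorem edgeRotor_imK (l : ℝ) : (edgeRotor l).imK = 0 := rfl
@[simp] theorem turnRotor_re (t : ℝ) : (turnRotor t).re = cos (t / 2) := rfl
@[simp] theorem turnRotor_imI (t : ℝ) : (turnRotor t).imI = 0 := rfl
@[simp] theorem turnRotor_imJ (t : ℝ) : (turnRotor t).imJ = 0 := rfl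
@[simp] theorem turnRotor_imK (t : ℝ) : (turnRotor t).imK = sin (t / 2) := rfl

theorem edgeRotor_add (s t : ℝ) : edgeRotor (s + t) = edgeRotor s * edgeRotor t := by
  ext <;> simp [add_div, cos_add, sin_add, add_comm]

theorem turnRotor_add (s t : ℝ) : turnRotor (s + t) = turnRotor s * turnRotor t := by
  ext <;> simp [add_div, cos_add, sin_add, add_comm]

@[simp] theorem edgeRotor_zero : edgeRotor 0 = 1 := by
  ext <;> simp

@[simp] theorem turnRotor_zero : turnRotor 0 = 1 := by
  ext <;> simp

theorem edgeRotor_mul_neg (l : ℝ) : edgeRotor l * edgeRotor (-l) = 1 := by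
  rw [← edgeRotor_add]; simp

theorem turnRotor_mul_neg (l : ℝ) : turnRotor l * turnRotor (-l) = 1 := by
  rw [← turnRotor_add]; simp

theorem turnRotor_neg_mul (l : ℝ) : turnRotor (-l) * turnRotor l = 1 := by
  rw [← turnRotor_add]; simp

theorem turnRotor_add_two_pi (t : ℝ) : turnRotor (t + 2 * π) = -turnRotor t := by
  have h : (t + 2 * π) / 2 = t / 2 + π := by ring
  ext <;> simp [h, cos_add_pi, sin_add_pi]

/-- A half turn, an edge and another half turn run the edge backwards. The sign is that of the full
turn: `turnRotor (2 * π) = -1`. This turns formal inverses into actual turns when a triangle is cut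
off. -/
theorem neg_edgeRotor_neg (l : ℝ) :
    -edgeRotor (-l) = turnRotor π * edgeRotor l * turnRotor π := by
  ext <;> simp [neg_div]

/-- An edge rotor e lies in the span of `1` and `j`, and `i` anticommutes with `j`, so e i e = i;
the span of `1, j, k` is preserved by q ↦ e q e. -/
theorem imI_edge_mul_edge (a : ℝ) (q : ℍ[ℝ]) :
    (edgeRotor a * q * edgeRotor a).imI = q.imI := by
  have ha := sin_sq_add_cos_sq (a / 2)
  simp only [edgeRotor_re, edgeRotor_imI, edgeRotor_imJ, edgeRotor_imK,
    Quaternion.imI_mul, Quaternion.re_mul, Quaternion.imJ_mul, Quaternion.imK_mul]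
  linear_combination q.imI * ha

/-- Moving `j` to the left past a turn inverts that turn, so the `j` part of q is multiplied by the
turn by t - s, and j k = i. The parts of q along `1` and `k` commute with turns and contribute
nothing. -/
theorem imI_turn_mul_turn (s t : ℝ) (q : ℍ[ℝ]) (hq : q.imI = 0) :
    (turnRotor s * q * turnRotor t).imI = q.imJ * sin ((t - s) / 2) := by
  simp only [turnRotor_re, turnRotor_imI, turnRotor_imJ, turnRotor_imK, sub_div, sin_sub, hq,
    Quaternion.imI_mul, Quaternion.re_mul, Quaternion.imJ_mul, Quaternion.imK_mul]
  ring

/-- A chain of rotors that is symmetric up to its two outer turns: the coefficient along the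
tangent axis. -/
theorem imI_edge_turn_edge (a t₁ t₂ b t₃ : ℝ) :
    (edgeRotor a * turnRotor t₁ * edgeRotor b * turnRotor t₂ * edgeRotor b * turnRotor t₃ *
      edgeRotor a).imI = sin b * cos (t₂ / 2) * sin ((t₃ - t₁) / 2) := by
  have hb : sin b = 2 * sin (b / 2) * cos (b / 2) := by rw [← sin_two_mul]; congr 1; ring
  have h : edgeRotor a * turnRotor t₁ * edgeRotor b * turnRotor t₂ * edgeRotor b * turnRotor t₃ *
      edgeRotor a = edgeRotor a * (turnRotor t₁ * (edgeRotor b * turnRotor t₂ * edgeRotor b) *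
        turnRotor t₃) * edgeRotor a := by noncomm_ring
  rw [h, imI_edge_mul_edge, imI_turn_mul_turn _ _ _ (by rw [imI_edge_mul_edge]; rfl)]
  simp only [edgeRotor_re, edgeRotor_imI, edgeRotor_imJ, edgeRotor_imK, turnRotor_re,
    turnRotor_imI, turnRotor_imJ, turnRotor_imK, hb,
    Quaternion.imI_mul, Quaternion.re_mul, Quaternion.imJ_mul, Quaternion.imK_mul]
  ring

theorem imI_turn_edge_turn (t₁ c t₂ : ℝ) :
    (turnRotor t₁ * edgeRotor c * turnRotor t₂).imI = sin (c / 2) * sin ((t₂ - t₁) / 2) := by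
  simp only [edgeRotor_re, edgeRotor_imI, edgeRotor_imJ, edgeRotor_imK,
    turnRotor_re, turnRotor_imI, turnRotor_imJ, turnRotor_imK, sub_div, sin_sub,
    Quaternion.imI_mul, Quaternion.re_mul, Quaternion.imJ_mul, Quaternion.imK_mul]
  ring

theorem imJ_turn_edge_turn (t₁ c t₂ : ℝ) :
    (turnRotor t₁ * edgeRotor c * turnRotor t₂).imJ = sin (c / 2) * cos ((t₂ - t₁) / 2) := by
  simp only [edgeRotor_re, edgeRotor_imI, edgeRotor_imJ, edgeRotor_imK,
    turnRotor_re, turnRotor_imI, turnRotor_imJ, turnRotor_imK, sub_div, cos_sub,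
    Quaternion.imI_mul, Quaternion.re_mul, Quaternion.imJ_mul, Quaternion.imK_mul]
  ring

theorem imJ_edge_turn_edge (a t b : ℝ) :
    (edgeRotor a * turnRotor t * edgeRotor b).imJ = cos (t / 2) * sin ((a + b) / 2) := by
  simp only [edgeRotor_re, edgeRotor_imI, edgeRotor_imJ, edgeRotor_imK,
    turnRotor_re, turnRotor_imI, turnRotor_imJ, turnRotor_imK, add_div, sin_add,
    Quaternion.imI_mul, Quaternion.re_mul, Quaternion.imJ_mul, Quaternion.imK_mul]
  ring

/-- The holonomy identity of a pentagon with edge lengths `b, a, c, a, b`. -/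
theorem pentagon_identity {t₀ t₁ t₂ t₃ t₄ a b c : ℝ}
    (h : turnRotor t₀ * edgeRotor b * turnRotor t₁ * edgeRotor a * turnRotor t₂ * edgeRotor c *
      turnRotor t₃ * edgeRotor a * turnRotor t₄ * edgeRotor b = -1) :
    sin b * cos (t₀ / 2) * sin ((t₁ - t₄) / 2) = sin (c / 2) * sin ((t₃ - t₂) / 2) := by
  -- The value `-1` is central, so the relation may be permuted cyclically. This puts t₀ in the
  -- middle, flanked symmetrically by b and a; V, the edge c with its two turns, is moved to the
  -- other side as an inverse.
  have key : edgeRotor a * turnRotor t₄ * edgeRotor b * turnRotor t₀ * edgeRotor b *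
      turnRotor t₁ * edgeRotor a = -(turnRotor (-t₃) * edgeRotor (-c) * turnRotor (-t₂)) := by
    set U := turnRotor t₀ * edgeRotor b * turnRotor t₁ * edgeRotor a with hU
    set W := edgeRotor a * turnRotor t₄ * edgeRotor b with hW
    set V := turnRotor t₂ * edgeRotor c * turnRotor t₃ with hV
    have h' : U * V * W = -1 := by rw [← h, hU, hV, hW]; noncomm_ring
    have hW0 : W ≠ 0 := by
      rintro h0; rw [h0, mul_zero] at h'; simpa using h'.symm
    have h2 : W * U * V = -1 := by
      apply mul_right_cancel₀ hW0
      calc W * U * V * W = W * (U * V * W) := by noncomm_ring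
        _ = -1 * W := by rw [h']; noncomm_ring
    have hVi : V * (turnRotor (-t₃) * edgeRotor (-c) * turnRotor (-t₂)) = 1 := by
      calc _ = turnRotor t₂ * (edgeRotor c * (turnRotor t₃ * turnRotor (-t₃)) * edgeRotor (-c)) *
            turnRotor (-t₂) := by rw [hV]; noncomm_ring
        _ = 1 := by simp [turnRotor_mul_neg, edgeRotor_mul_neg]
    calc _ = W * U * (V * (turnRotor (-t₃) * edgeRotor (-c) * turnRotor (-t₂))) := by
          rw [hVi, hU, hW]; noncomm_ring
      _ = (W * U * V) * (turnRotor (-t₃) * edgeRotor (-c) * turnRotor (-t₂)) := by noncomm_ring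
      _ = _ := by rw [h2]; noncomm_ring
  have h3 := congrArg QuaternionAlgebra.imI key
  rw [imI_edge_turn_edge, Quaternion.imI_neg, imI_turn_edge_turn] at h3
  rw [h3, neg_div, sin_neg]
  have : (-t₂ - -t₃) / 2 = (t₃ - t₂) / 2 := by ring
  rw [this]; ring

/-! ### Triple products, spherical distances and turns in coordinates -/

/-- The triple product of three vectors. -/
def det3 (a b c : Space3) : ℝ := inner ℝ a (cross3 b c)

theorem inner_coord (a b : Space3) : inner ℝ a b = a 0 * b 0 + a 1 * b 1 + a 2 * b 2 := by
  simp [PiLp.inner_apply, Fin.sum_univ_three, mul_comm]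

theorem norm_sq_coord (a : Space3) : ‖a‖ ^ 2 = a 0 ^ 2 + a 1 ^ 2 + a 2 ^ 2 := by
  rw [← real_inner_self_eq_norm_sq, inner_coord]; ring

@[simp] theorem cross3_zero (a b : Space3) : cross3 a b 0 = a 1 * b 2 - a 2 * b 1 := by
  simp [cross3, cross_apply]

@[simp] theorem cross3_one (a b : Space3) : cross3 a b 1 = a 2 * b 0 - a 0 * b 2 := by
  simp [cross3, cross_apply]

@[simp] theorem cross3_two (a b : Space3) : cross3 a b 2 = a 0 * b 1 - a 1 * b 0 := by
  simp [cross3, cross_apply]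

theorem ext_coord {a b : Space3} (h0 : a 0 = b 0) (h1 : a 1 = b 1) (h2 : a 2 = b 2) : a = b := by
  ext i; fin_cases i <;> assumption

theorem det3_coord (a b c : Space3) : det3 a b c =
    a 0 * (b 1 * c 2 - b 2 * c 1) + a 1 * (b 2 * c 0 - b 0 * c 2) +
      a 2 * (b 0 * c 1 - b 1 * c 0) := by
  rw [det3, inner_coord]; simp

theorem det3_rotate (a b c : Space3) : det3 b c a = det3 a b c := by
  simp only [det3_coord]; ring

theorem det3_swap (a b c : Space3) : det3 a c b = -det3 a b c := by
  simp only [det3_coord]; ring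

theorem norm_cross3_sq (a b : Space3) :
    ‖cross3 a b‖ ^ 2 = ‖a‖ ^ 2 * ‖b‖ ^ 2 - inner ℝ a b ^ 2 := by
  simp only [norm_sq_coord, inner_coord, cross3_zero, cross3_one, cross3_two]; ring

/-- The signed angle in `(-π, π]` by which a path on the sphere turns left at `u`, when it comes
straight from `w` and continues straight to `z`. -/
def turn (u w z : Space3) : ℝ :=
  Complex.arg ⟨-inner ℝ (cross3 u w) (cross3 u z), -(‖u‖ * det3 u w z)⟩

/-- The spherical distance of two nonzero vectors. -/
abbrev arc (u w : Space3) : ℝ := InnerProductGeometry.angle u w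

theorem ne_zero_of_cross3_ne_zero {u w : Space3} (h : cross3 u w ≠ 0) : u ≠ 0 ∧ w ≠ 0 := by
  constructor <;> rintro rfl <;> exact h (ext_coord (by simp) (by simp) (by simp))

theorem cos_arc {u w : Space3} (hu : u ≠ 0) (hw : w ≠ 0) :
    ‖u‖ * ‖w‖ * cos (arc u w) = inner ℝ u w := by
  rw [InnerProductGeometry.cos_angle]
  have := norm_pos_iff.2 hu
  have := norm_pos_iff.2 hw
  field_simp

theorem sin_arc {u w : Space3} (hu : u ≠ 0) (hw : w ≠ 0) :
    ‖u‖ * ‖w‖ * sin (arc u w) = ‖cross3 u w‖ := by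
  have h1 : 0 ≤ sin (arc u w) := InnerProductGeometry.sin_angle_nonneg u w
  have h2 := cos_arc hu hw
  have h3 := norm_cross3_sq u w
  rw [← abs_of_nonneg (norm_nonneg (cross3 u w)),
    ← abs_of_nonneg (by positivity : 0 ≤ ‖u‖ * ‖w‖ * sin (arc u w)), ← sq_eq_sq_iff_abs_eq_abs, h3,
    ← h2, mul_pow, sin_sq]
  ring

theorem arc_pos {u w : Space3} (h : cross3 u w ≠ 0) : 0 < arc u w := by
  obtain ⟨hu, hw⟩ := ne_zero_of_cross3_ne_zero h
  refine lt_of_le_of_ne (InnerProductGeometry.angle_nonneg u w) fun h0 => h ?_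
  rw [← norm_eq_zero, ← sin_arc hu hw, ← h0]; simp

theorem arc_lt_pi {u w : Space3} (h : cross3 u w ≠ 0) : arc u w < π := by
  obtain ⟨hu, hw⟩ := ne_zero_of_cross3_ne_zero h
  refine lt_of_le_of_ne (InnerProductGeometry.angle_le_pi u w) fun h0 => h ?_
  rw [← norm_eq_zero, ← sin_arc hu hw, h0]; simp

theorem turn_norm_sq (u w z : Space3) :
    inner ℝ (cross3 u w) (cross3 u z) ^ 2 + (‖u‖ * det3 u w z) ^ 2 =
      (‖cross3 u w‖ * ‖cross3 u z‖) ^ 2 := by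
  simp only [mul_pow, norm_sq_coord, inner_coord, cross3_zero, cross3_one, cross3_two, det3_coord]
  ring

theorem norm_turn (u w z : Space3) :
    ‖(⟨-inner ℝ (cross3 u w) (cross3 u z), -(‖u‖ * det3 u w z)⟩ : ℂ)‖ =
      ‖cross3 u w‖ * ‖cross3 u z‖ := by
  rw [← abs_of_nonneg (norm_nonneg (Complex.mk _ _)),
    ← abs_of_nonneg (by positivity : 0 ≤ ‖cross3 u w‖ * ‖cross3 u z‖), ← sq_eq_sq_iff_abs_eq_abs,
    ← turn_norm_sq, Complex.sq_norm, Complex.normSq_apply]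
  ring

theorem cos_turn (u w z : Space3) :
    ‖cross3 u w‖ * ‖cross3 u z‖ * cos (turn u w z) = -inner ℝ (cross3 u w) (cross3 u z) := by
  rw [turn, ← norm_turn, Complex.norm_mul_cos_arg]

theorem sin_turn (u w z : Space3) :
    ‖cross3 u w‖ * ‖cross3 u z‖ * sin (turn u w z) = -(‖u‖ * det3 u w z) := by
  rw [turn, ← norm_turn, Complex.norm_mul_sin_arg]

/-! ### Moving frames and the holonomy of a triangle -/

/-- The linear map from pure quaternions to space given by the moving frame with position `p` and
normal `n`. -/
def frameMap (n p : Space3) (x : ℍ[ℝ]) : Space3 :=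
  x.imI • cross3 n p + x.imJ • n + x.imK • p

/-- The motion is expressed in the frame itself, not in fixed coordinates, so the rotors of
successive motions multiply on the right, in the order of travel. -/
theorem frameMap_edge {n p : Space3} (h : cross3 n (cross3 n p) = -p) (l : ℝ) (x : ℍ[ℝ]) :
    frameMap n (cos l • p + sin l • cross3 n p) x =
      frameMap n p (edgeRotor l * x * star (edgeRotor l)) := by
  have hc : cos l = cos (l / 2) ^ 2 - sin (l / 2) ^ 2 := by
    rw [← cos_two_mul']; congr 1; ring
  have hs : sin l = 2 * sin (l / 2) * cos (l / 2) := by rw [← sin_two_mul]; congr 1; ring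
  have h1 := sin_sq_add_cos_sq (l / 2)
  have h2 : cross3 n (cos l • p + sin l • cross3 n p) =
      cos l • cross3 n p - sin l • p := by
    have : cross3 n (cos l • p + sin l • cross3 n p) =
      cos l • cross3 n p + sin l • cross3 n (cross3 n p) := by
      apply ext_coord <;> simp <;> ring
    rw [this, h]; module
  rw [frameMap, h2, frameMap, hc, hs]
  simp only [Quaternion.imI_mul, Quaternion.re_mul, Quaternion.imJ_mul, Quaternion.imK_mul,
    Quaternion.re_star, Quaternion.imI_star, Quaternion.imJ_star, Quaternion.imK_star,
    edgeRotor_re, edgeRotor_imI, edgeRotor_imJ, edgeRotor_imK]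
  match_scalars <;> first | ring1 | linear_combination (-x.imJ) * h1

theorem frameMap_turn {n p : Space3} (h : cross3 (cross3 n p) p = -n) (t : ℝ) (x : ℍ[ℝ]) :
    frameMap (cos t • n - sin t • cross3 n p) p x =
      frameMap n p (turnRotor t * x * star (turnRotor t)) := by
  have hc : cos t = cos (t / 2) ^ 2 - sin (t / 2) ^ 2 := by
    rw [← cos_two_mul']; congr 1; ring
  have hs : sin t = 2 * sin (t / 2) * cos (t / 2) := by rw [← sin_two_mul]; congr 1; ring
  have h1 := sin_sq_add_cos_sq (t / 2)
  have h2 : cross3 (cos t • n - sin t • cross3 n p) p = cos t • cross3 n p + sin t • n := by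
    have : cross3 (cos t • n - sin t • cross3 n p) p =
      cos t • cross3 n p - sin t • cross3 (cross3 n p) p := by
      apply ext_coord <;> simp <;> ring
    rw [this, h]; module
  rw [frameMap, h2, frameMap, hc, hs]
  simp only [Quaternion.imI_mul, Quaternion.re_mul, Quaternion.imJ_mul, Quaternion.imK_mul,
    Quaternion.re_star, Quaternion.imI_star, Quaternion.imJ_star, Quaternion.imK_star,
    turnRotor_re, turnRotor_imI, turnRotor_imJ, turnRotor_imK]
  match_scalars <;> first | ring1 | linear_combination (-x.imK) * h1

theorem frameMap_injective {n p : Space3} (hn : ‖n‖ = 1) (hp : ‖p‖ = 1) (hnp : inner ℝ n p = 0)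
    {x y : ℍ[ℝ]} (h : frameMap n p x = frameMap n p y) :
    x.imI = y.imI ∧ x.imJ = y.imJ ∧ x.imK = y.imK := by
  have hn2 : inner ℝ n n = (1 : ℝ) := by rw [real_inner_self_eq_norm_sq, hn]; norm_num
  have hp2 : inner ℝ p p = (1 : ℝ) := by rw [real_inner_self_eq_norm_sq, hp]; norm_num
  have htt : inner ℝ (cross3 n p) (cross3 n p) = (1 : ℝ) := by
    rw [real_inner_self_eq_norm_sq, norm_cross3_sq, hn, hp, hnp]; norm_num
  have htt' : ‖cross3 n p‖ = 1 := by
    rw [real_inner_self_eq_norm_sq] at htt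
    nlinarith [norm_nonneg (cross3 n p)]
  have htn : inner ℝ (cross3 n p) n = (0 : ℝ) := by
    simp only [inner_coord, cross3_zero, cross3_one, cross3_two]; ring
  have htp : inner ℝ (cross3 n p) p = (0 : ℝ) := by
    simp only [inner_coord, cross3_zero, cross3_one, cross3_two]; ring
  have key : ∀ z : ℍ[ℝ], inner ℝ (cross3 n p) (frameMap n p z) = z.imI ∧
      inner ℝ n (frameMap n p z) = z.imJ ∧ inner ℝ p (frameMap n p z) = z.imK := by
    intro z
    refine ⟨?_, ?_, ?_⟩ <;>
    simp [frameMap, inner_add_right, inner_smul_right, htn, htp, hnp, hn, hp,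
      real_inner_comm (cross3 n p), real_inner_comm n p, htt']
  obtain ⟨x1, x2, x3⟩ := key x
  obtain ⟨y1, y2, y3⟩ := key y
  rw [h] at x1 x2 x3
  exact ⟨x1.symm.trans y1, x2.symm.trans y2, x3.symm.trans y3⟩

theorem cross3_cross3_self {n p : Space3} (hn : ‖n‖ = 1) (hnp : inner ℝ n p = 0) :
    cross3 n (cross3 n p) = -p := by
  have h1 := norm_sq_coord n
  rw [hn] at h1
  rw [inner_coord] at hnp
  apply ext_coord <;> simp
  · linear_combination n 0 * hnp + p 0 * h1
  · linear_combination n 1 * hnp + p 1 * h1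
  · linear_combination n 2 * hnp + p 2 * h1

theorem cross3_self_cross3 {n p : Space3} (hp : ‖p‖ = 1) (hnp : inner ℝ n p = 0) :
    cross3 (cross3 n p) p = -n := by
  have h1 := norm_sq_coord p
  rw [hp] at h1
  rw [inner_coord] at hnp
  apply ext_coord <;> simp
  · linear_combination p 0 * hnp + n 0 * h1
  · linear_combination p 1 * hnp + n 1 * h1
  · linear_combination p 2 * hnp + n 2 * h1

/-- The unit vector in the direction of `v`. -/
def hat (v : Space3) : Space3 := ‖v‖⁻¹ • v

theorem norm_hat {v : Space3} (hv : v ≠ 0) : ‖hat v‖ = 1 := by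
  rw [hat, norm_smul, norm_inv, norm_norm, inv_mul_cancel₀ (norm_ne_zero_iff.2 hv)]

theorem inner_cross3_left (u w : Space3) : inner ℝ (cross3 u w) u = (0 : ℝ) := by
  simp only [inner_coord, cross3_zero, cross3_one, cross3_two]; ring

theorem inner_cross3_right (u w : Space3) : inner ℝ (cross3 u w) w = (0 : ℝ) := by
  simp only [inner_coord, cross3_zero, cross3_one, cross3_two]; ring

theorem inner_hat_left (u w : Space3) : inner ℝ (hat (cross3 u w)) (hat u) = (0 : ℝ) := by
  simp [hat, inner_smul_left, inner_smul_right, inner_cross3_left]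

theorem inner_hat_right (u w : Space3) : inner ℝ (hat (cross3 u w)) (hat w) = (0 : ℝ) := by
  simp [hat, inner_smul_left, inner_smul_right, inner_cross3_right]

theorem cross3_smul_smul (a b : ℝ) (u w : Space3) :
    cross3 (a • u) (b • w) = (a * b) • cross3 u w := by
  apply ext_coord <;> simp <;> ring

theorem cross3_cross3_left (u w : Space3) :
    cross3 (cross3 u w) u = ‖u‖ ^ 2 • w - inner ℝ u w • u := by
  rw [norm_sq_coord, inner_coord]
  apply ext_coord <;> simp <;> ring

theorem edge_end {u w : Space3} (h : cross3 u w ≠ 0) :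
    cos (arc u w) • hat u + sin (arc u w) • cross3 (hat (cross3 u w)) (hat u) = hat w := by
  obtain ⟨hu, hw⟩ := ne_zero_of_cross3_ne_zero h
  have hu' := norm_pos_iff.2 hu
  have hw' := norm_pos_iff.2 hw
  have hn := norm_pos_iff.2 h
  have h1 : cos (arc u w) = inner ℝ u w / (‖u‖ * ‖w‖) := by
    rw [eq_div_iff (by positivity), ← cos_arc hu hw]; ring
  have h2 : sin (arc u w) = ‖cross3 u w‖ / (‖u‖ * ‖w‖) := by
    rw [eq_div_iff (by positivity), ← sin_arc hu hw]; ring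
  simp only [hat]
  rw [cross3_smul_smul, cross3_cross3_left, h1, h2]
  match_scalars <;> field_simp
  ring

theorem turn_end {u w z : Space3} (h : cross3 w u ≠ 0) (h' : cross3 u z ≠ 0) :
    cos (turn u w z) • hat (cross3 w u) -
      sin (turn u w z) • cross3 (hat (cross3 w u)) (hat u) = hat (cross3 u z) := by
  obtain ⟨hu, hz⟩ := ne_zero_of_cross3_ne_zero h'
  have hu' := norm_pos_iff.2 hu
  have hn := norm_pos_iff.2 h
  have hn' := norm_pos_iff.2 h'
  have hsw : cross3 u w = -cross3 w u := by apply ext_coord <;> simp <;> ring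
  have h1 : cos (turn u w z) =
      inner ℝ (cross3 w u) (cross3 u z) / (‖cross3 w u‖ * ‖cross3 u z‖) := by
    have := cos_turn u w z
    rw [hsw, norm_neg, inner_neg_left, neg_neg] at this
    rw [eq_div_iff (by positivity), ← this]; ring
  have h2 : sin (turn u w z) = ‖u‖ * det3 w u z / (‖cross3 w u‖ * ‖cross3 u z‖) := by
    have := sin_turn u w z
    rw [hsw, norm_neg, ← mul_neg] at this
    rw [eq_div_iff (by positivity), ← det3_rotate, det3_swap, ← this]; ring
  -- Expansion of the new normal in the orthogonal basis of the plane perpendicular to u that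
  -- consists of the old normal and the old tangent, cleared of denominators.
  have h3 : ‖cross3 w u‖ ^ 2 • cross3 u z = inner ℝ (cross3 w u) (cross3 u z) • cross3 w u -
      det3 w u z • cross3 (cross3 w u) u := by
    rw [norm_sq_coord, inner_coord, det3_coord]
    apply ext_coord <;> simp <;> ring
  have h4 : cross3 u z = (‖cross3 w u‖ ^ 2)⁻¹ • (inner ℝ (cross3 w u) (cross3 u z) • cross3 w u -
      det3 w u z • cross3 (cross3 w u) u) := by
    rw [← h3, smul_smul, inv_mul_cancel₀ (by positivity), one_smul]
  have h5 : hat (cross3 u z) = ‖cross3 u z‖⁻¹ • ((‖cross3 w u‖ ^ 2)⁻¹ •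
      (inner ℝ (cross3 w u) (cross3 u z) • cross3 w u - det3 w u z • cross3 (cross3 w u) u)) := by
    rw [← h4, hat]
  rw [h5, h1, h2]
  simp only [hat]
  rw [cross3_smul_smul]
  match_scalars <;> field_simp

theorem frameMap_edge_hat {u w : Space3} (h : cross3 u w ≠ 0) (x : ℍ[ℝ]) :
    frameMap (hat (cross3 u w)) (hat w) x = frameMap (hat (cross3 u w)) (hat u)
      (edgeRotor (arc u w) * x * star (edgeRotor (arc u w))) := by
  rw [← frameMap_edge (cross3_cross3_self (norm_hat h) (inner_hat_left u w)), edge_end h]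

theorem frameMap_turn_hat {u w z : Space3} (h : cross3 w u ≠ 0) (h' : cross3 u z ≠ 0)
    (x : ℍ[ℝ]) :
    frameMap (hat (cross3 u z)) (hat u) x = frameMap (hat (cross3 w u)) (hat u)
      (turnRotor (turn u w z) * x * star (turnRotor (turn u w z))) := by
  have hu := (ne_zero_of_cross3_ne_zero h).2
  rw [← frameMap_turn (cross3_self_cross3 (norm_hat hu) (inner_hat_right w u)), turn_end h h']

theorem normSq_edgeRotor (l : ℝ) : normSq (edgeRotor l) = 1 := by
  simp [Quaternion.normSq_def']

theorem normSq_turnRotor (l : ℝ) : normSq (turnRotor l) = 1 := by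
  simp [Quaternion.normSq_def']

/-- It suffices to test on `k = turnRotor π` and `j = edgeRotor π`: a rotation that fixes both axes
has a lift without imaginary part. -/
theorem eq_one_or_neg_one_of_conj {m : ℍ[ℝ]} (hm : normSq m = 1)
    (h : ∀ x : ℍ[ℝ], (m * x * star m).imI = x.imI ∧ (m * x * star m).imJ = x.imJ ∧
      (m * x * star m).imK = x.imK) : m = 1 ∨ m = -1 := by
  rw [Quaternion.normSq_def'] at hm
  have hK := (h (turnRotor π)).2.2
  have hJ := (h (edgeRotor π)).2.1
  simp only [Quaternion.imI_mul, Quaternion.re_mul, Quaternion.imJ_mul, Quaternion.imK_mul,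
    Quaternion.re_star, Quaternion.imI_star, Quaternion.imJ_star, Quaternion.imK_star,
    edgeRotor_re, edgeRotor_imI, edgeRotor_imJ, edgeRotor_imK, turnRotor_re,
    turnRotor_imI, turnRotor_imJ, turnRotor_imK, cos_pi_div_two, sin_pi_div_two] at hJ hK
  have h1 : m.imI = 0 := by nlinarith [sq_nonneg m.imI, sq_nonneg m.imJ]
  have h2 : m.imJ = 0 := by nlinarith [sq_nonneg m.imI, sq_nonneg m.imJ]
  have h3 : m.imK = 0 := by nlinarith [sq_nonneg m.imI, sq_nonneg m.imK]
  rw [h1, h2, h3] at hm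
  have : m.re = 1 ∨ m.re = -1 := by
    have : (m.re - 1) * (m.re + 1) = 0 := by linarith
    rcases mul_eq_zero.1 this with h | h
    · left; linarith
    · right; linarith
  rcases this with h0 | h0
  · left; ext <;> simp [h0, h1, h2, h3]
  · right; ext <;> simp [h0, h1, h2, h3]

theorem cross3_ne_zero_of_det3 {a b c : Space3} (h : det3 a b c ≠ 0) : cross3 b c ≠ 0 := by
  intro h0; apply h; rw [det3, h0, inner_zero_right]

theorem turn_pos {u w z : Space3} (h : det3 u w z < 0) : 0 < turn u w z ∧ turn u w z < π := by
  have hu : 0 < ‖u‖ := by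
    rw [norm_pos_iff]; rintro rfl; simp [det3] at h
  have h' : 0 < -(‖u‖ * det3 u w z) := by nlinarith
  refine ⟨lt_of_le_of_ne (Complex.arg_nonneg_iff.2 h'.le) fun h0 => ?_,
    Complex.arg_lt_pi_iff.2 (Or.inr h'.ne')⟩
  exact h'.ne' (Complex.arg_eq_zero_iff.1 h0.symm).2

theorem turn_neg {u w z : Space3} (h : 0 < det3 u w z) : -π < turn u w z ∧ turn u w z < 0 := by
  have hu : 0 < ‖u‖ := by
    rw [norm_pos_iff]; rintro rfl; simp [det3] at h
  have h' : -(‖u‖ * det3 u w z) < 0 := by nlinarith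
  exact ⟨Complex.neg_pi_lt_arg _, Complex.arg_neg_iff.2 h'⟩

theorem turn_bounds {u w z : Space3} (h : det3 u w z ≠ 0) : -π < turn u w z ∧ turn u w z < π := by
  have := pi_pos
  rcases lt_or_gt_of_ne h with h | h
  · have := turn_pos h; constructor <;> linarith
  · have := turn_neg h; constructor <;> linarith

/-- The frame carried once around the triangle returns to itself, so conjugation by the holonomy is
trivial. Only the sign of the lift stays undetermined. -/
theorem triangle_rotor_eq_one_or {a b c : Space3} (hab : cross3 a b ≠ 0) (hbc : cross3 b c ≠ 0)
    (hca : cross3 c a ≠ 0) {m : ℍ[ℝ]} (hm : m = turnRotor (turn a c b) * edgeRotor (arc a b) *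
      turnRotor (turn b a c) * edgeRotor (arc b c) * turnRotor (turn c b a) *
      edgeRotor (arc c a)) : m = 1 ∨ m = -1 := by
  have ha := (ne_zero_of_cross3_ne_zero hab).1
  apply eq_one_or_neg_one_of_conj
  · rw [hm]; simp only [map_mul, normSq_edgeRotor, normSq_turnRotor, mul_one]
  intro x
  refine frameMap_injective (norm_hat hca) (norm_hat ha) (inner_hat_right c a) ?_
  conv_rhs => rw [frameMap_edge_hat hca, frameMap_turn_hat hbc hca, frameMap_edge_hat hbc,
    frameMap_turn_hat hab hbc, frameMap_edge_hat hab, frameMap_turn_hat hca hab]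
  congr 1
  simp only [hm, star_mul, mul_assoc]

/-- The rotor holonomy of a nondegenerate triangle. -/
theorem triangle_rotor {a b c : Space3} (h : det3 a b c ≠ 0) :
    turnRotor (turn a c b) * edgeRotor (arc a b) * turnRotor (turn b a c) * edgeRotor (arc b c) *
      turnRotor (turn c b a) * edgeRotor (arc c a) = -1 := by
  have hbc := cross3_ne_zero_of_det3 h
  have hab : cross3 a b ≠ 0 := cross3_ne_zero_of_det3 (a := c) (by rwa [← det3_rotate])
  have hca : cross3 c a ≠ 0 := cross3_ne_zero_of_det3 (a := b) (by rwa [det3_rotate])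
  set m := turnRotor (turn a c b) * edgeRotor (arc a b) * turnRotor (turn b a c) *
    edgeRotor (arc b c) * turnRotor (turn c b a) * edgeRotor (arc c a) with hm
  refine (triangle_rotor_eq_one_or hab hbc hca hm).resolve_left fun h1 => ?_
  -- If the holonomy were `1`, two sides would equal the inverse of the rest. The `j` coefficient is
  -- positive on the left and negative on the right: the sides are shorter than π, and the turns at
  -- a and c have the same sign, so they differ by less than π.
  have key : edgeRotor (arc a b) * turnRotor (turn b a c) * edgeRotor (arc b c) =
      turnRotor (-turn a c b) * edgeRotor (-arc c a) * turnRotor (-turn c b a) := by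
    calc _ = (turnRotor (-turn a c b) * turnRotor (turn a c b)) * (edgeRotor (arc a b) *
          turnRotor (turn b a c) * edgeRotor (arc b c)) * (turnRotor (turn c b a) *
          (edgeRotor (arc c a) * edgeRotor (-arc c a)) * turnRotor (-turn c b a)) := by
            simp [turnRotor_neg_mul, edgeRotor_mul_neg, turnRotor_mul_neg]
      _ = turnRotor (-turn a c b) * m * edgeRotor (-arc c a) * turnRotor (-turn c b a) := by
            rw [hm]; noncomm_ring
      _ = _ := by rw [h1, mul_one]
  have h2 := congrArg QuaternionAlgebra.imJ key
  rw [imJ_edge_turn_edge, imJ_turn_edge_turn, neg_div, sin_neg] at h2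
  have hs1 : det3 a c b = -det3 a b c := det3_swap a b c
  have hs2 : det3 b a c = -det3 a b c := by rw [← det3_rotate, hs1]
  have hs3 : det3 c b a = -det3 a b c := by rw [← det3_rotate, hs2]
  have hba := turn_bounds (u := b) (w := a) (z := c) (by rw [hs2]; simpa using h)
  have hdiff : -π < turn a c b - turn c b a ∧ turn a c b - turn c b a < π := by
    rcases lt_or_gt_of_ne h with h | h
    · have := turn_neg (u := a) (w := c) (z := b) (by linarith)
      have := turn_neg (u := c) (w := b) (z := a) (by linarith)
      constructor <;> linarith
    · have := turn_pos (u := a) (w := c) (z := b) (by linarith)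
      have := turn_pos (u := c) (w := b) (z := a) (by linarith)
      constructor <;> linarith
  have p1 : 0 < cos (turn b a c / 2) := cos_pos_of_mem_Ioo ⟨by linarith, by linarith⟩
  have p2 : 0 < cos ((-turn c b a - -turn a c b) / 2) :=
    cos_pos_of_mem_Ioo ⟨by linarith, by linarith⟩
  have p3 : 0 < sin ((arc a b + arc b c) / 2) :=
    sin_pos_of_pos_of_lt_pi (by linarith [arc_pos hab, arc_pos hbc])
      (by linarith [arc_lt_pi hab, arc_lt_pi hbc])
  have p4 : 0 < sin (arc c a / 2) :=
    sin_pos_of_pos_of_lt_pi (by linarith [arc_pos hca]) (by linarith [arc_lt_pi hca, pi_pos])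
  nlinarith [mul_pos p1 p3, mul_pos p2 p4]

/-! ### Orientation signs: crossings, triangles and sums of turns -/

/-- Whether a real number is positive. -/
def pos (x : ℝ) : Bool := decide (0 < x)

/-- The sign `-1` for `true` and `1` for `false`. -/
def boolSign (b : Bool) : ℝ := if b then -1 else 1

theorem boolSign_xor (a b : Bool) : boolSign (a ^^ b) = boolSign a * boolSign b := by
  cases a <;> cases b <;> simp [boolSign]

theorem boolSign_mul_self (a : Bool) : boolSign a * boolSign a = 1 := by
  cases a <;> simp [boolSign]

@[simp] theorem boolSign_false : boolSign false = 1 := rfl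

theorem pos_neg {x : ℝ} (hx : x ≠ 0) : pos (-x) = !pos x := by
  rcases lt_or_gt_of_ne hx with h | h <;> simp [pos, h, h.le]

theorem pos_mul {x y : ℝ} (hx : x ≠ 0) (hy : y ≠ 0) : pos (x * y) = !(pos x ^^ pos y) := by
  rcases lt_or_gt_of_ne hx with h | h <;> rcases lt_or_gt_of_ne hy with h' | h' <;>
    simp [pos, h, h', not_lt.2 h.le, not_lt.2 h'.le, mul_pos_iff]

/-- Whether the open great arcs from `a` to `b` and from `c` to `d` cross, for vectors in general
position. -/
def crosses (a b c d : Space3) : Bool :=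
  (pos (det3 b c d) ^^ pos (det3 a c d)) && (pos (det3 a b d) ^^ pos (det3 a b c)) &&
    (pos (det3 b c d) ^^ pos (det3 a b d))

/-- Whether `p` is inside the spherical triangle `a b c`, for vectors in general position. -/
def inTriangle (a b c p : Space3) : Bool :=
  !(pos (det3 a b p) ^^ pos (det3 a b c)) && !(pos (det3 b c p) ^^ pos (det3 a b c)) &&
    !(pos (det3 c a p) ^^ pos (det3 a b c))

/-- Whether the sum of the turns from `x` to `y` and from `y` to `z` at a point exceeds the turn
from `x` to `z` by `-π` rather than by `π`, modulo `4π`, given the orientations of `x, z`, of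
`x, y` and of `y, z`. -/
def wraps (a b d : Bool) : Bool := (b && d) || (!a && (b || d))

/-- The linear relation among four vectors in space has triple products as coefficients. Only two
opposite sign patterns satisfy `crosses`, and both place a, b on one side and c, d on the other with
positive weights. -/
theorem crosses_geom {a b c d : Space3} (h : crosses a b c d = true)
    (ha : det3 b c d ≠ 0) (hb : det3 a c d ≠ 0) (hc : det3 a b d ≠ 0) (hd : det3 a b c ≠ 0) :
    ∃ x y z w : ℝ, 0 < x ∧ 0 < y ∧ 0 < z ∧ 0 < w ∧ x • a + y • b = z • c + w • d := by
  have key : det3 b c d • a - det3 a c d • b = det3 a b c • d - det3 a b d • c := by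
    simp only [det3_coord]
    apply ext_coord <;> simp <;> ring
  simp only [crosses, Bool.and_eq_true] at h
  obtain ⟨⟨h1, h2⟩, h3⟩ := h
  rcases lt_or_gt_of_ne ha with ha | ha <;> rcases lt_or_gt_of_ne hb with hb | hb <;>
  rcases lt_or_gt_of_ne hc with hc | hc <;> rcases lt_or_gt_of_ne hd with hd | hd <;>
  simp [pos, ha, hb, hc, hd, not_lt.2 ha.le, not_lt.2 hb.le,
    not_lt.2 hc.le, not_lt.2 hd.le] at h1 h2 h3
  · refine ⟨-det3 b c d, det3 a c d, det3 a b d, -det3 a b c, by linarith, hb, hc, by linarith, ?_⟩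
    rw [← sub_eq_zero] at key ⊢; rw [← neg_eq_zero, ← key]; module
  · refine ⟨det3 b c d, -det3 a c d, -det3 a b d, det3 a b c, ha, by linarith, by linarith, hd, ?_⟩
    rw [← sub_eq_zero] at key ⊢; rw [← key]; module

theorem det3_ne_swap {a b c : Space3} (h : det3 a b c ≠ 0) : det3 a c b ≠ 0 := by
  rw [det3_swap]; exact neg_ne_zero.2 h

/-- The sign defect at the vertex where the ear begins, with r in the role of the predecessor of o.
The orientation of the ear occurs again in `wraps_end`, so only inclusions and crossings survive in
the product of the two. -/
theorem wraps_start {o p q r : Space3} (h1 : det3 o p q ≠ 0) (h2 : det3 o p r ≠ 0)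
    (h3 : det3 o q r ≠ 0) :
    wraps (pos (det3 o r p)) (pos (det3 o r q)) (pos (det3 o q p)) =
      (inTriangle o p q r ^^ crosses p q r o ^^ !pos (det3 o p q)) := by
  have e1 : det3 q r o = det3 o q r := det3_rotate o q r
  have e2 : det3 p r o = det3 o p r := det3_rotate o p r
  have e3 : det3 p q o = det3 o p q := det3_rotate o p q
  have e4 : det3 q o r = -det3 o q r := by simp only [det3_coord]; ring
  rw [wraps, inTriangle, crosses, e1, e2, e3, e4, det3_swap o p r, det3_swap o q r,
    det3_swap o p q, pos_neg h1, pos_neg h2, pos_neg h3]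
  generalize pos (det3 o p q) = a; generalize pos (det3 o p r) = b
  generalize pos (det3 o q r) = c; generalize pos (det3 p q r) = d
  revert a b c d; decide

theorem wraps_end {o p q r : Space3} (h1 : det3 o p q ≠ 0)
    (h3 : det3 o q r ≠ 0) (h4 : det3 p q r ≠ 0) :
    wraps (pos (det3 q p r)) (pos (det3 q p o)) (pos (det3 q o r)) =
      (inTriangle o p q r ^^ crosses o p q r ^^ !pos (det3 o p q)) := by
  have e1 : det3 q p r = -det3 p q r := by simp only [det3_coord]; ring
  have e2 : det3 q p o = -det3 o p q := by simp only [det3_coord]; ring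
  have e4 : det3 q o r = -det3 o q r := by simp only [det3_coord]; ring
  rw [wraps, inTriangle, crosses, e1, e2, e4, pos_neg h1, pos_neg h4, pos_neg h3]
  generalize pos (det3 o p q) = a; generalize pos (det3 o p r) = b
  generalize pos (det3 o q r) = c; generalize pos (det3 p q r) = d
  revert a b c d; decide

/-- The excluded pattern would give x y, -z w and u t a common sign, and they could not sum to zero.
-/
theorem pluecker_pos {x y z w u t : ℝ} (hx : x ≠ 0) (hy : y ≠ 0) (hz : z ≠ 0) (hw : w ≠ 0)
    (hu : u ≠ 0) (ht : t ≠ 0) (h : x * y - z * w + u * t = 0) :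
    (((pos x ^^ pos y) ^^ (pos z ^^ pos w)) && ((pos z ^^ pos w) ^^ (pos u ^^ pos t))) = false := by
  have h1 := pos_mul hx hy
  have h2 := pos_mul hz hw
  have h3 := pos_mul hu ht
  have e1 : (pos x ^^ pos y) = !pos (x * y) := by rw [h1]; simp
  have e2 : (pos z ^^ pos w) = !pos (z * w) := by rw [h2]; simp
  have e3 : (pos u ^^ pos t) = !pos (u * t) := by rw [h3]; simp
  rw [e1, e2, e3]
  have n1 := mul_ne_zero hx hy
  have n2 := mul_ne_zero hz hw
  have n3 := mul_ne_zero hu ht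
  generalize x * y = A at *
  generalize z * w = B at *
  generalize u * t = C at *
  rcases lt_or_gt_of_ne n1 with n1 | n1 <;> rcases lt_or_gt_of_ne n2 with n2 | n2 <;>
  rcases lt_or_gt_of_ne n3 with n3 | n3 <;>
  first
  | (exfalso; linarith)
  | simp [pos, n1, n2, n3, not_lt.2 n1.le, not_lt.2 n2.le, not_lt.2 n3.le]

-- The parity argument for a triangle: a segment changes sides once for every boundary edge it
-- crosses. Among the ten orientation signs of five vectors, five Grassmann–Plücker relations
-- exclude enough patterns for the rest to be a finite check.
set_option maxRecDepth 100000 in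
theorem crosses_triangle {a b c p q : Space3} (habc : det3 a b c ≠ 0) (habp : det3 a b p ≠ 0)
    (hacp : det3 a c p ≠ 0) (hbcp : det3 b c p ≠ 0) (habq : det3 a b q ≠ 0)
    (hacq : det3 a c q ≠ 0) (hbcq : det3 b c q ≠ 0) (hapq : det3 a p q ≠ 0)
    (hbpq : det3 b p q ≠ 0) (hcpq : det3 c p q ≠ 0) :
    (inTriangle a b c p ^^ inTriangle a b c q) =
      (crosses a b p q ^^ crosses b c p q ^^ crosses a c p q) := by
  have g1 := pluecker_pos habc hapq habp hacq habq hacp (by simp only [det3_coord]; ring)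
  have g2 := pluecker_pos habc hbpq habp hbcq habq hbcp (by simp only [det3_coord]; ring)
  have g3 := pluecker_pos habc hcpq hacp hbcq hacq hbcp (by simp only [det3_coord]; ring)
  have g4 := pluecker_pos habp hcpq hacp hbpq hapq hbcp (by simp only [det3_coord]; ring)
  have g5 := pluecker_pos habq hcpq hacq hbpq hapq hbcq (by simp only [det3_coord]; ring)
  have e1 : det3 c a p = -det3 a c p := by simp only [det3_coord]; ring
  have e2 : det3 c a q = -det3 a c q := by simp only [det3_coord]; ring
  simp only [inTriangle, crosses, e1, e2, pos_neg hacp, pos_neg hacq]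
  revert g1 g2 g3 g4 g5
  generalize pos (det3 a b c) = x1
  generalize pos (det3 a b p) = x2
  generalize pos (det3 a c p) = x3
  generalize pos (det3 b c p) = x4
  generalize pos (det3 a b q) = x5
  generalize pos (det3 a c q) = x6
  generalize pos (det3 b c q) = x7
  generalize pos (det3 a p q) = x8
  generalize pos (det3 b p q) = x9
  generalize pos (det3 c p q) = x10
  revert x1 x2 x3 x4 x5 x6 x7 x8 x9 x10
  decide

/-- Turns add up to a half turn modulo 2π, but a rotor sees its angle modulo 4π. The three
orientations decide which multiple of 2π occurs. -/
theorem turn_add {u x y z : Space3} (hxz : det3 u x z ≠ 0) (hxy : det3 u x y ≠ 0)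
    (hyz : det3 u y z ≠ 0) :
    turnRotor (turn u x z + π) =
      boolSign (wraps (pos (det3 u x z)) (pos (det3 u x y)) (pos (det3 u y z))) •
        turnRotor (turn u x y + turn u y z) := by
  have hu : 0 < ‖u‖ := by
    rw [norm_pos_iff]; rintro rfl; simp [det3] at hxz
  set A : ℂ := ⟨-inner ℝ (cross3 u x) (cross3 u z), -(‖u‖ * det3 u x z)⟩ with hA
  set B : ℂ := ⟨-inner ℝ (cross3 u x) (cross3 u y), -(‖u‖ * det3 u x y)⟩ with hB
  set D : ℂ := ⟨-inner ℝ (cross3 u y) (cross3 u z), -(‖u‖ * det3 u y z)⟩ with hD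
  have hA0 : A ≠ 0 := fun h => by
    have := congrArg Complex.im h
    simp [hA] at this
    exact this.elim (fun h => hu.ne' (by simp [h])) hxz
  have hB0 : B ≠ 0 := fun h => by
    have := congrArg Complex.im h
    simp [hB] at this
    exact this.elim (fun h => hu.ne' (by simp [h])) hxy
  have hD0 : D ≠ 0 := fun h => by
    have := congrArg Complex.im h
    simp [hD] at this
    exact this.elim (fun h => hu.ne' (by simp [h])) hyz
  have hc : 0 < ‖cross3 u y‖ ^ 2 := by
    have : cross3 u y ≠ 0 := cross3_ne_zero_of_det3 (a := z) (by rwa [← det3_rotate])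
    positivity
  -- The complex numbers defining the turns multiply up to a positive factor; the minus sign
  -- supplies the extra π.
  have hprod : B * D = ((‖cross3 u y‖ ^ 2 : ℝ) : ℂ) * -A := by
    have hn := norm_sq_coord u
    apply Complex.ext
    · simp only [hA, hB, hD, Complex.mul_re, Complex.ofReal_re, Complex.ofReal_im, Complex.neg_re,
        Complex.neg_im]
      have : (‖u‖ * det3 u x y) * (‖u‖ * det3 u y z) = ‖u‖ ^ 2 * (det3 u x y * det3 u y z) := by
        ring
      simp only [neg_mul_neg, this, hn]
      simp only [norm_sq_coord, inner_coord, cross3_zero, cross3_one, cross3_two, det3_coord]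
      ring
    · simp only [hA, hB, hD, Complex.mul_im, Complex.ofReal_re, Complex.ofReal_im, Complex.neg_re,
        Complex.neg_im]
      simp only [norm_sq_coord, inner_coord, cross3_zero, cross3_one, cross3_two, det3_coord]
      ring
  have hang : ((turn u x y + turn u y z : ℝ) : Angle) = ((turn u x z + π : ℝ) : Angle) := by
    rw [Angle.coe_add, Angle.coe_add]
    change ((Complex.arg B : ℝ) : Angle) + (Complex.arg D : ℝ) = (Complex.arg A : ℝ) + (π : ℝ)
    rw [← Complex.arg_mul_coe_angle hB0 hD0, hprod, Complex.arg_real_mul _ hc,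
      Complex.arg_neg_coe_angle hA0]
  -- Each orientation places its turn in (-π, 0) or (0, π), and these bounds leave only k = 0 or k =
  -- -1.
  obtain ⟨k, hk⟩ := Angle.angle_eq_iff_two_pi_dvd_sub.1 hang
  have hpi := pi_pos
  have hk0 : k = 0 → turnRotor (turn u x z + π) = turnRotor (turn u x y + turn u y z) := by
    rintro rfl
    congr 1
    simp at hk; linarith
  have hk1 : k = -1 → turnRotor (turn u x z + π) = -turnRotor (turn u x y + turn u y z) := by
    rintro rfl
    rw [← turnRotor_add_two_pi]
    congr 1
    push_cast at hk; linarith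
  have hlow : 2 * π * (-2) < 2 * π * k → 2 * π * k < 2 * π * 0 → k = -1 := by
    intro h1 h2
    have h1 : (-2 : ℝ) < k := lt_of_mul_lt_mul_left h1 (by positivity)
    have h2 : (k : ℝ) < 0 := lt_of_mul_lt_mul_left h2 (by positivity)
    have h1 : -2 < k := by exact_mod_cast h1
    have h2 : k < 0 := by exact_mod_cast h2
    omega
  have hhigh : 2 * π * (-1) < 2 * π * k → 2 * π * k < 2 * π * 1 → k = 0 := by
    intro h1 h2
    have h1 : (-1 : ℝ) < k := lt_of_mul_lt_mul_left h1 (by positivity)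
    have h2 : (k : ℝ) < 1 := lt_of_mul_lt_mul_left h2 (by positivity)
    have h1 : -1 < k := by exact_mod_cast h1
    have h2 : k < 1 := by exact_mod_cast h2
    omega
  rcases lt_or_gt_of_ne hxz with s1 | s1 <;> rcases lt_or_gt_of_ne hxy with s2 | s2 <;>
  rcases lt_or_gt_of_ne hyz with s3 | s3 <;>
  simp only [pos, s1, s2, s3, not_lt.2 s1.le, not_lt.2 s2.le, not_lt.2 s3.le, wraps, decide_true,
    decide_false, boolSign, Bool.and_self, Bool.and_true, Bool.and_false,
    Bool.or_true, Bool.or_false, Bool.not_true, Bool.not_false, if_true, one_smul, neg_smul,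
    Bool.or_self, Bool.false_eq_true, if_false] <;>
  first
  | have b1 := turn_pos s1
  | have b1 := turn_neg s1
  all_goals first
  | have b2 := turn_pos s2
  | have b2 := turn_neg s2
  all_goals first
  | have b3 := turn_pos s3
  | have b3 := turn_neg s3
  all_goals first
  | exact hk0 (hhigh (by linarith [b1.1, b1.2, b2.1, b2.2, b3.1, b3.2])
    (by linarith [b1.1, b1.2, b2.1, b2.2, b3.1, b3.2]))
  | exact hk1 (hlow (by linarith [b1.1, b1.2, b2.1, b2.2, b3.1, b3.2])
    (by linarith [b1.1, b1.2, b2.1, b2.2, b3.1, b3.2]))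

/-! ### Cutting off ears: holonomy of polygons in general position -/

/-- The rotor of the chain of `d + 1` edges from `v j` to `v (j + d + 1)`. -/
def chainRotor (v : ℕ → Space3) : ℕ → ℕ → ℍ[ℝ]
  | j, 0 => edgeRotor (arc (v j) (v (j + 1)))
  | j, d + 1 => edgeRotor (arc (v j) (v (j + 1))) *
      turnRotor (turn (v (j + 1)) (v j) (v (j + 2))) * chainRotor v (j + 1) d

/-- The rotor holonomy of the closed polygon `v 0, v k, v (k + 1), …, v (k + d)`, provided that
`v (k + d + 1) = v 0`. -/
def fanRotor (v : ℕ → Space3) (k d : ℕ) : ℍ[ℝ] :=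
  turnRotor (turn (v 0) (v (k + d)) (v k)) * edgeRotor (arc (v 0) (v k)) *
    turnRotor (turn (v k) (v 0) (v (k + 1))) * chainRotor v k d

theorem arc_comm (u w : Space3) : arc u w = arc w u := InnerProductGeometry.angle_comm u w

/-- Cutting off a triangle: two edges of a chain are replaced by the third side. -/
theorem edge_turn_edge {o p q : Space3} (h : det3 o p q ≠ 0) :
    edgeRotor (arc o p) * turnRotor (turn p o q) * edgeRotor (arc p q) =
      turnRotor (π - turn o q p) * edgeRotor (arc o q) * turnRotor (π - turn q p o) := by
  have ht := triangle_rotor h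
  have e : turnRotor (π - turn o q p) * edgeRotor (arc o q) * turnRotor (π - turn q p o) =
      turnRotor (-turn o q p) * -edgeRotor (-arc o q) * turnRotor (-turn q p o) := by
    rw [neg_edgeRotor_neg, sub_eq_neg_add, turnRotor_add, sub_eq_add_neg π, turnRotor_add]
    noncomm_ring
  rw [e]
  calc _ = (turnRotor (-turn o q p) * turnRotor (turn o q p)) * (edgeRotor (arc o p) *
        turnRotor (turn p o q) * edgeRotor (arc p q)) * (turnRotor (turn q p o) *
        (edgeRotor (arc q o) * edgeRotor (-arc q o)) * turnRotor (-turn q p o)) := by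
          simp [turnRotor_neg_mul, edgeRotor_mul_neg, turnRotor_mul_neg]
    _ = turnRotor (-turn o q p) * (turnRotor (turn o q p) * edgeRotor (arc o p) *
        turnRotor (turn p o q) * edgeRotor (arc p q) * turnRotor (turn q p o) *
        edgeRotor (arc q o)) * edgeRotor (-arc q o) * turnRotor (-turn q p o) := by noncomm_ring
    _ = _ := by rw [ht, arc_comm q o]; noncomm_ring

theorem turn_cut {u x y z : Space3} (hxz : det3 u x z ≠ 0) (hxy : det3 u x y ≠ 0)
    (hyz : det3 u y z ≠ 0) :
    turnRotor (turn u x z + (π - turn u y z)) =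
      boolSign (wraps (pos (det3 u x z)) (pos (det3 u x y)) (pos (det3 u y z))) •
        turnRotor (turn u x y) := by
  have e : turn u x z + (π - turn u y z) = turn u x z + π + -turn u y z := by ring
  rw [e, turnRotor_add, turn_add hxz hxy hyz, turnRotor_add, smul_mul_assoc, mul_assoc,
    turnRotor_mul_neg, mul_one]

theorem turn_cut' {u x y z : Space3} (hxz : det3 u x z ≠ 0) (hxy : det3 u x y ≠ 0)
    (hyz : det3 u y z ≠ 0) :
    turnRotor (π - turn u x y + turn u x z) =
      boolSign (wraps (pos (det3 u x z)) (pos (det3 u x y)) (pos (det3 u y z))) •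
        turnRotor (turn u y z) := by
  have e : π - turn u x y + turn u x z = -turn u x y + (turn u x z + π) := by ring
  rw [e, turnRotor_add, turn_add hxz hxy hyz, turnRotor_add, mul_smul_comm, ← mul_assoc,
    turnRotor_neg_mul, one_mul]

/-- Cutting the ear `p` off a polygon with consecutive vertices `n, o, p, q, r`. -/
theorem ear_rotor {n o p q r : Space3} (h : det3 o p q ≠ 0) (hnp : det3 o p n ≠ 0)
    (hnq : det3 o q n ≠ 0) (hor : det3 o q r ≠ 0) (hpr : det3 p q r ≠ 0) :
    turnRotor (turn o n p) * edgeRotor (arc o p) * turnRotor (turn p o q) *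
      edgeRotor (arc p q) * turnRotor (turn q p r) =
    boolSign (inTriangle o p q n ^^ crosses p q n o ^^ inTriangle o p q r ^^ crosses o p q r) •
      (turnRotor (turn o n q) * edgeRotor (arc o q) * turnRotor (turn q o r)) := by
  have h1 : det3 o q p ≠ 0 := det3_ne_swap h
  have h2 : det3 q p o ≠ 0 := by rw [det3_rotate]; exact h1
  have h3 : det3 q p r ≠ 0 := by rw [← det3_rotate]; exact det3_ne_swap hpr
  have h4 : det3 q o r ≠ 0 := by rw [← det3_rotate]; exact det3_ne_swap hor
  have e := edge_turn_edge h
  calc _ = turnRotor (turn o n p) * (edgeRotor (arc o p) * turnRotor (turn p o q) *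
        edgeRotor (arc p q)) * turnRotor (turn q p r) := by noncomm_ring
    _ = turnRotor (turn o n p + (π - turn o q p)) * edgeRotor (arc o q) *
        turnRotor (π - turn q p o + turn q p r) := by
          rw [e, turnRotor_add, turnRotor_add (π - turn q p o)]; noncomm_ring
    _ = _ := by
      rw [turn_cut (det3_ne_swap hnp) (det3_ne_swap hnq) h1, turn_cut' h3 h2 h4,
        wraps_start h hnp hnq, wraps_end h hor hpr]
      simp only [smul_mul_assoc, mul_smul_comm, smul_smul]
      congr 1
      simp only [boolSign_xor]
      -- The orientation of the ear enters once at each end and squares to 1.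
      linear_combination boolSign (inTriangle o p q r) * boolSign (crosses o p q r) *
        boolSign (inTriangle o p q n) * boolSign (crosses p q n o) *
        boolSign_mul_self (!pos (det3 o p q))

/-- The rotor holonomy of a fan polygon, by the crossings of its first edge. -/
theorem fanRotor_eq {v : ℕ → Space3} {m : ℕ} (hper : v (m + 1) = v 0)
    (hgen : ∀ i j k, i ≤ m → j ≤ m → k ≤ m → i ≠ j → j ≠ k → i ≠ k → det3 (v i) (v j) (v k) ≠ 0)
    (hcross : ∀ i j, 1 ≤ i → i + 1 < j → j ≤ m →
      crosses (v i) (v (i + 1)) (v j) (v (j + 1)) = false) :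
    ∀ d k, 1 ≤ k → k + (d + 1) = m → fanRotor v k (d + 1) =
      (-∏ j ∈ Finset.Ico (k + 1) m, boolSign (crosses (v 0) (v k) (v j) (v (j + 1)))) •
        (1 : ℍ[ℝ]) := by
  intro d
  induction d with
  | zero =>
    intro k hk hm
    have := triangle_rotor (hgen 0 k (k + 1) (by omega) (by omega) (by omega) (by omega)
      (by omega) (by omega))
    have h0 : k + (0 + 1) = k + 1 := by omega
    rw [fanRotor, chainRotor, chainRotor, show k + 2 = m + 1 by omega, hper, h0, ← hm]
    simp only [zero_add, Finset.Ico_self, Finset.prod_empty, neg_smul, one_smul]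
    rw [← this]
    noncomm_ring
  | succ d ih =>
    intro k hk hm
    have hg : ∀ i j l, i ≤ m → j ≤ m → l ≤ m → i < j → j < l → det3 (v i) (v j) (v l) ≠ 0 :=
      fun i j l h1 h2 h3 h4 h5 => hgen i j l h1 h2 h3 (by omega) (by omega) (by omega)
    have hkm : k + (d + 1 + 1) = m := hm
    have ear := ear_rotor (n := v m) (o := v 0) (p := v k) (q := v (k + 1)) (r := v (k + 2))
      (hg _ _ _ (by omega) (by omega) (by omega) (by omega) (by omega))
      (hg _ _ _ (by omega) (by omega) (by omega) (by omega) (by omega))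
      (hg _ _ _ (by omega) (by omega) (by omega) (by omega) (by omega))
      (hg _ _ _ (by omega) (by omega) (by omega) (by omega) (by omega))
      (hg _ _ _ (by omega) (by omega) (by omega) (by omega) (by omega))
    have hc1 : crosses (v k) (v (k + 1)) (v m) (v 0) = false := by
      rw [← hper]; exact hcross _ _ hk (by omega) le_rfl
    -- Walk along the chain from `v (k + 2)` to `v m`. Membership in the ear changes only across the
    -- two diagonals from `v 0`, because the third side `v k`, `v (k + 1)` is an edge of the polygon
    -- that the chain does not cross.
    have hin : ∀ e, k + 2 + e ≤ m → boolSign (inTriangle (v 0) (v k) (v (k + 1)) (v (k + 2 + e))) =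
        boolSign (inTriangle (v 0) (v k) (v (k + 1)) (v (k + 2))) *
        ∏ j ∈ Finset.Ico (k + 2) (k + 2 + e), (boolSign (crosses (v 0) (v k) (v j) (v (j + 1))) *
          boolSign (crosses (v 0) (v (k + 1)) (v j) (v (j + 1)))) := by
      intro e
      induction e with
      | zero => simp
      | succ e ihe =>
        intro he
        have := crosses_triangle (a := v 0) (b := v k) (c := v (k + 1)) (p := v (k + 2 + e))
          (q := v (k + 2 + e + 1))
          (hg _ _ _ (by omega) (by omega) (by omega) (by omega) (by omega))
          (hg _ _ _ (by omega) (by omega) (by omega) (by omega) (by omega))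
          (hg _ _ _ (by omega) (by omega) (by omega) (by omega) (by omega))
          (hg _ _ _ (by omega) (by omega) (by omega) (by omega) (by omega))
          (hg _ _ _ (by omega) (by omega) (by omega) (by omega) (by omega))
          (hg _ _ _ (by omega) (by omega) (by omega) (by omega) (by omega))
          (hg _ _ _ (by omega) (by omega) (by omega) (by omega) (by omega))
          (hg _ _ _ (by omega) (by omega) (by omega) (by omega) (by omega))
          (hg _ _ _ (by omega) (by omega) (by omega) (by omega) (by omega))
          (hg _ _ _ (by omega) (by omega) (by omega) (by omega) (by omega))
        have hc := hcross k (k + 2 + e) hk (by omega) (by omega)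
        rw [hc] at this
        have h1 := congrArg boolSign this
        simp only [boolSign_xor, boolSign_false, mul_one] at h1
        rw [← add_assoc, Finset.prod_Ico_succ_top (by omega), ← mul_assoc, ← ihe (by omega), ← h1,
          ← mul_assoc, boolSign_mul_self, one_mul]
    have hin := hin (d) (by omega)
    rw [show k + 2 + d = m by omega] at hin
    have ih := ih (k + 1) (by omega) (by omega)
    rw [fanRotor, show k + 1 + (d + 1) = m by omega, show k + 1 + 1 = k + 2 from rfl] at ih
    rw [fanRotor, hkm, chainRotor]
    calc _ = (turnRotor (turn (v 0) (v m) (v k)) * edgeRotor (arc (v 0) (v k)) *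
          turnRotor (turn (v k) (v 0) (v (k + 1))) * edgeRotor (arc (v k) (v (k + 1))) *
          turnRotor (turn (v (k + 1)) (v k) (v (k + 2)))) * chainRotor v (k + 1) (d + 1) := by
            noncomm_ring
      _ = _ := by
        rw [ear, smul_mul_assoc, ih, smul_smul, hc1]
        congr 1
        rw [Finset.prod_eq_prod_Ico_succ_bot (show k + 1 < m by omega)]
        simp only [boolSign_xor, boolSign_false, mul_one, hin, Finset.prod_mul_distrib]
        have e1 := boolSign_mul_self (inTriangle (v 0) (v k) (v (k + 1)) (v (k + 2)))
        -- Crossings of the new diagonal `v 0`, `v (k + 1)` are counted twice, by the induction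
        -- hypothesis and by the walk through the ear, so they cancel. What remains are the
        -- crossings of the old diagonal.
        have e2 : (∏ j ∈ Finset.Ico (k + 2) m,
            boolSign (crosses (v 0) (v (k + 1)) (v j) (v (j + 1)))) *
            (∏ j ∈ Finset.Ico (k + 2) m,
            boolSign (crosses (v 0) (v (k + 1)) (v j) (v (j + 1)))) = 1 := by
          rw [← Finset.prod_mul_distrib]
          exact Finset.prod_eq_one fun j _ => boolSign_mul_self _
        generalize (∏ j ∈ Finset.Ico (k + 2) m,
            boolSign (crosses (v 0) (v (k + 1)) (v j) (v (j + 1)))) = B at *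
        simp only [show k + 1 + 1 = k + 2 from rfl]
        generalize (∏ j ∈ Finset.Ico (k + 2) m,
            boolSign (crosses (v 0) (v k) (v j) (v (j + 1)))) = A at *
        generalize boolSign (inTriangle (v 0) (v k) (v (k + 1)) (v (k + 2))) = s at *
        generalize boolSign (crosses (v 0) (v k) (v (k + 1)) (v (k + 2))) = t at *
        linear_combination (-A * t * B * B) * e1 - A * t * e2

/-- A simple closed polygon in general position has rotor holonomy `-1`. -/
theorem fanRotor_eq_neg_one {v : ℕ → Space3} {m : ℕ} (hm : 2 ≤ m) (hper : v (m + 1) = v 0)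
    (hgen : ∀ i j k, i ≤ m → j ≤ m → k ≤ m → i ≠ j → j ≠ k → i ≠ k → det3 (v i) (v j) (v k) ≠ 0)
    (hcross : ∀ i j, i + 1 < j → j ≤ m → ¬(i = 0 ∧ j = m) →
      crosses (v i) (v (i + 1)) (v j) (v (j + 1)) = false) :
    fanRotor v 1 (m - 1) = -1 := by
  obtain ⟨d, rfl⟩ : ∃ d, m = d + 2 := ⟨m - 2, by omega⟩
  have h := fanRotor_eq hper hgen (fun i j h1 h2 h3 => hcross i j h2 h3 (by omega)) d 1 le_rfl
    (by omega)
  rw [show d + 2 - 1 = d + 1 by omega, h, Finset.prod_eq_one]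
  · simp
  · intro j hj
    rw [Finset.mem_Ico] at hj
    have := hcross 0 j (by omega) (by omega) (by omega)
    rw [zero_add] at this
    rw [this, boolSign_false]

/-! ### Continuity and perturbation into general position -/

open Filter Topology

theorem continuous_edgeRotor : Continuous edgeRotor := by
  have : edgeRotor = fun l => cos (l / 2) • (1 : ℍ[ℝ]) + sin (l / 2) • edgeRotor π := by
    funext l; ext <;> simp
  rw [this]; fun_prop

theorem continuous_turnRotor : Continuous turnRotor := by
  have : turnRotor = fun l => cos (l / 2) • (1 : ℍ[ℝ]) + sin (l / 2) • turnRotor π := by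
    funext l; ext <;> simp
  rw [this]; fun_prop

theorem continuous_cross3 : Continuous fun p : Space3 × Space3 => cross3 p.1 p.2 := by
  have : (fun p : Space3 × Space3 => cross3 p.1 p.2) = fun p => WithLp.toLp 2
      ![p.1 1 * p.2 2 - p.1 2 * p.2 1, p.1 2 * p.2 0 - p.1 0 * p.2 2,
        p.1 0 * p.2 1 - p.1 1 * p.2 0] := by
    funext p; apply ext_coord <;> simp
  rw [this]
  apply (PiLp.continuous_toLp 2 _).comp
  apply continuous_pi
  intro i
  fin_cases i <;> simp <;> fun_prop

/-- The two arcs met at `u`, coming from `w` and going to `z`, do not reverse direction. -/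
def NoReversal (u w z : Space3) : Prop :=
  (⟨-inner ℝ (cross3 u w) (cross3 u z), -(‖u‖ * det3 u w z)⟩ : ℂ) ∈ Complex.slitPlane

theorem continuousAt_turn {u w z : ℝ → Space3} {x : ℝ} (hu : ContinuousAt u x)
    (hw : ContinuousAt w x) (hz : ContinuousAt z x) (h : NoReversal (u x) (w x) (z x)) :
    ContinuousAt (fun e => turn (u e) (w e) (z e)) x := by
  have hc : ∀ {f g : ℝ → Space3}, ContinuousAt f x → ContinuousAt g x →
      ContinuousAt (fun e => cross3 (f e) (g e)) x := fun {f g} hf hg =>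
    ContinuousAt.comp (f := fun e => (f e, g e)) continuous_cross3.continuousAt (hf.prodMk hg)
  have h1 : ContinuousAt (fun e => -inner ℝ (cross3 (u e) (w e)) (cross3 (u e) (z e))) x :=
    (ContinuousAt.inner (𝕜 := ℝ) (hc hu hw) (hc hu hz)).neg
  have h2 : ContinuousAt (fun e => -(‖u e‖ * det3 (u e) (w e) (z e))) x :=
    (hu.norm.mul (ContinuousAt.inner (𝕜 := ℝ) hu (hc hw hz))).neg
  have h3 : ContinuousAt (fun e => (⟨-inner ℝ (cross3 (u e) (w e)) (cross3 (u e) (z e)),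
      -(‖u e‖ * det3 (u e) (w e) (z e))⟩ : ℂ)) x :=
    ContinuousAt.comp (g := Complex.equivRealProdCLM.symm)
      (f := fun e => (-inner ℝ (cross3 (u e) (w e)) (cross3 (u e) (z e)),
        -(‖u e‖ * det3 (u e) (w e) (z e))))
      Complex.equivRealProdCLM.symm.continuous.continuousAt (h1.prodMk h2)
  exact ContinuousAt.comp (g := Complex.arg) (Complex.continuousAt_arg h) h3

theorem continuousAt_arc {u w : ℝ → Space3} {x : ℝ} (hu : ContinuousAt u x)
    (hw : ContinuousAt w x) (hu0 : u x ≠ 0) (hw0 : w x ≠ 0) :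
    ContinuousAt (fun e => arc (u e) (w e)) x :=
  ContinuousAt.comp (f := fun e => (u e, w e)) (InnerProductGeometry.continuousAt_angle hu0 hw0)
    (hu.prodMk hw)

theorem continuousAt_chainRotor {u : ℝ → ℕ → Space3} {x : ℝ}
    (hu : ∀ i, ContinuousAt (fun e => u e i) x) (h0 : ∀ i, u x i ≠ 0) (d : ℕ) :
    ∀ j, (∀ i < d, NoReversal (u x (j + i + 1)) (u x (j + i)) (u x (j + i + 2))) →
      ContinuousAt (fun e => chainRotor (u e) j d) x := by
  induction d with
  | zero =>
    intro j _
    exact continuous_edgeRotor.continuousAt.comp (continuousAt_arc (hu _) (hu _) (h0 _) (h0 _))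
  | succ d ih =>
    intro j h
    refine ContinuousAt.mul (ContinuousAt.mul ?_ ?_) (ih (j + 1) fun i hi => ?_)
    · exact continuous_edgeRotor.continuousAt.comp (continuousAt_arc (hu _) (hu _) (h0 _) (h0 _))
    · exact continuous_turnRotor.continuousAt.comp
        (continuousAt_turn (hu _) (hu _) (hu _) (h 0 (by omega)))
    · have := h (i + 1) (by omega)
      rwa [show j + 1 + i = j + (i + 1) by omega]

theorem continuousAt_fanRotor {u : ℝ → ℕ → Space3} {x : ℝ}
    (hu : ∀ i, ContinuousAt (fun e => u e i) x) (h0 : ∀ i, u x i ≠ 0) (d : ℕ)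
    (h1 : NoReversal (u x 0) (u x (1 + d)) (u x 1))
    (h : ∀ i ≤ d, NoReversal (u x (i + 1)) (u x i) (u x (i + 2))) :
    ContinuousAt (fun e => fanRotor (u e) 1 d) x := by
  refine ContinuousAt.mul (ContinuousAt.mul (ContinuousAt.mul ?_ ?_) ?_)
    (continuousAt_chainRotor hu h0 _ _ fun i hi => ?_)
  · exact continuous_turnRotor.continuousAt.comp (continuousAt_turn (hu _) (hu _) (hu _) h1)
  · exact continuous_edgeRotor.continuousAt.comp (continuousAt_arc (hu _) (hu _) (h0 _) (h0 _))
  · exact continuous_turnRotor.continuousAt.comp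
      (continuousAt_turn (hu _) (hu _) (hu _) (h 0 (by omega)))
  · have := h (i + 1) (by omega)
    rwa [show 1 + i = i + 1 by omega]

/-- The determinant is a polynomial in e with leading coefficient `det3 p q r`, hence has finitely
many roots. -/
theorem eventually_det3_ne_zero (a b c : Space3) {p q r : Space3} (h : det3 p q r ≠ 0) :
    ∀ᶠ e : ℝ in 𝓝[≠] 0, det3 (a + e • p) (b + e • q) (c + e • r) ≠ 0 := by
  let P : Polynomial ℝ := Polynomial.C (det3 a b c) +
    Polynomial.C (det3 p b c + det3 a q c + det3 a b r) * Polynomial.X +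
    Polynomial.C (det3 p q c + det3 p b r + det3 a q r) * Polynomial.X ^ 2 +
    Polynomial.C (det3 p q r) * Polynomial.X ^ 3
  have hP : P ≠ 0 := by
    intro h0
    have := congrArg (Polynomial.coeff · 3) h0
    simp only [P, Polynomial.coeff_add, Polynomial.coeff_C_mul, Polynomial.coeff_X,
      Polynomial.coeff_C, Polynomial.coeff_X_pow, Polynomial.coeff_zero] at this
    norm_num at this
    exact h this
  have hev : ∀ e : ℝ, P.eval e = det3 (a + e • p) (b + e • q) (c + e • r) := by
    intro e
    simp only [P, Polynomial.eval_add, Polynomial.eval_mul, Polynomial.eval_C, Polynomial.eval_X,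
      Polynomial.eval_pow, det3_coord, PiLp.add_apply, PiLp.smul_apply, smul_eq_mul]
    ring
  have hfin : ({e | P.IsRoot e} \ {0}).Finite :=
    (Polynomial.finite_setOfPred_isRoot hP).subset Set.sdiff_subset
  have hmem : ({e | P.IsRoot e} \ {0})ᶜ ∈ 𝓝 (0 : ℝ) :=
    hfin.isClosed.isOpen_compl.mem_nhds (by simp)
  filter_upwards [mem_nhdsWithin_of_mem_nhds hmem, self_mem_nhdsWithin] with e h1 h2 h3
  exact h1 ⟨by simp [Polynomial.IsRoot, hev, h3], h2⟩

/-- The closed arcs from `a` to `b` and from `c` to `d` are shorter than `π` and disjoint. -/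
def ArcsDisjoint (a b c d : Space3) : Prop :=
  ∀ x y z w : ℝ, 0 ≤ x → 0 ≤ y → 0 ≤ z → 0 ≤ w → x • a + y • b = z • c + w • d →
    x = 0 ∧ y = 0 ∧ z = 0 ∧ w = 0

/-- By homogeneity the weights may be normalised to the standard simplex. There the norm attains its
minimum, which disjointness makes positive. -/
theorem ArcsDisjoint.exists_bound {a b c d : Space3} (h : ArcsDisjoint a b c d) :
    ∃ δ > 0, ∀ x y z w : ℝ, 0 ≤ x → 0 ≤ y → 0 ≤ z → 0 ≤ w →
      δ * (x + y + z + w) ≤ ‖x • a + y • b - (z • c + w • d)‖ := by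
  have hcont : Continuous fun f : Fin 4 → ℝ => ‖f 0 • a + f 1 • b - (f 2 • c + f 3 • d)‖ := by
    fun_prop
  obtain ⟨g, hg, hmin⟩ := (isCompact_stdSimplex ℝ (Fin 4)).exists_isMinOn
    ⟨_, single_mem_stdSimplex ℝ (0 : Fin 4)⟩ hcont.continuousOn
  refine ⟨_, lt_of_le_of_ne (norm_nonneg (g 0 • a + g 1 • b - (g 2 • c + g 3 • d))) fun h0 => ?_,
    fun x y z w hx hy hz hw => ?_⟩
  · have := h _ _ _ _ (hg.1 0) (hg.1 1) (hg.1 2) (hg.1 3)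
      (sub_eq_zero.1 (norm_eq_zero.1 h0.symm))
    have hs := hg.2
    simp [Fin.sum_univ_four, this] at hs
  · set s := x + y + z + w with hs
    rcases (by positivity : 0 ≤ s).eq_or_lt with h0 | h0
    · rw [← h0]; simp
    have hm := hmin (a := ![x / s, y / s, z / s, w / s]) (by
      refine ⟨fun i => ?_, ?_⟩
      · fin_cases i <;> simp <;> positivity
      · simp only [Fin.sum_univ_four]; simp; field_simp; rw [hs])
    simp only [Set.mem_ofPred_eq] at hm
    have e : x • a + y • b - (z • c + w • d) =
        s • ((x / s) • a + (y / s) • b - ((z / s) • c + (w / s) • d)) := by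
      match_scalars <;> field_simp
    rw [e, norm_smul, Real.norm_of_nonneg h0.le, mul_comm]
    exact mul_le_mul_of_nonneg_left hm h0.le

/-- Perturbing the endpoints moves the difference of the two combinations by at most |e| C times the
sum of the weights, which the uniform bound δ absorbs for small e. -/
theorem ArcsDisjoint.eventually {a b c d : Space3} (h : ArcsDisjoint a b c d)
    (p q r t : Space3) : ∀ᶠ e : ℝ in 𝓝 0, ∀ x y z w : ℝ, 0 < x → 0 < y → 0 < z → 0 < w →
      x • (a + e • p) + y • (b + e • q) ≠ z • (c + e • r) + w • (d + e • t) := by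
  obtain ⟨δ, hδ, hb⟩ := h.exists_bound
  set C := ‖p‖ + ‖q‖ + ‖r‖ + ‖t‖ with hC
  have hlim : Tendsto (fun e : ℝ => |e| * C) (𝓝 0) (𝓝 0) := by
    have : Continuous fun e : ℝ => |e| * C := by fun_prop
    simpa using this.tendsto 0
  filter_upwards [hlim.eventually (gt_mem_nhds hδ)] with e he x y z w hx hy hz hw heq
  have h1 := hb x y z w hx.le hy.le hz.le hw.le
  have h2 : x • a + y • b - (z • c + w • d) = e • (z • r + w • t - x • p - y • q) := by
    rw [← sub_eq_zero] at heq ⊢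
    rw [← heq]; module
  have h3 : ‖z • r + w • t - x • p - y • q‖ ≤ C * (x + y + z + w) := by
    have n1 : ‖z • r + w • t - x • p - y • q‖ ≤ z * ‖r‖ + w * ‖t‖ + x * ‖p‖ + y * ‖q‖ := by
      refine (norm_sub_le _ _).trans (add_le_add ((norm_sub_le _ _).trans (add_le_add
        ((norm_add_le _ _).trans (add_le_add ?_ ?_)) ?_)) ?_) <;>
      rw [norm_smul, Real.norm_of_nonneg (by assumption : (0 : ℝ) < _).le]
    nlinarith [norm_nonneg p, norm_nonneg q, norm_nonneg r, norm_nonneg t,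
      mul_nonneg hx.le (norm_nonneg q), mul_nonneg hx.le (norm_nonneg r),
      mul_nonneg hx.le (norm_nonneg t), mul_nonneg hy.le (norm_nonneg p),
      mul_nonneg hy.le (norm_nonneg r), mul_nonneg hy.le (norm_nonneg t),
      mul_nonneg hz.le (norm_nonneg p), mul_nonneg hz.le (norm_nonneg q),
      mul_nonneg hz.le (norm_nonneg t), mul_nonneg hw.le (norm_nonneg p),
      mul_nonneg hw.le (norm_nonneg q), mul_nonneg hw.le (norm_nonneg r)]
  rw [h2, norm_smul, Real.norm_eq_abs] at h1
  have h4 : |e| * ‖z • r + w • t - x • p - y • q‖ ≤ |e| * C * (x + y + z + w) := by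
    rw [mul_assoc]; exact mul_le_mul_of_nonneg_left h3 (abs_nonneg e)
  have h5 : 0 < x + y + z + w := by positivity
  nlinarith

/-- Points of the moment curve, any three of which are linearly independent. -/
def moment (n : ℕ) : Space3 := WithLp.toLp 2 ![1, (n : ℝ), (n : ℝ) ^ 2]

theorem det3_moment {i j k : ℕ} (hij : i ≠ j) (hjk : j ≠ k) (hik : i ≠ k) :
    det3 (moment i) (moment j) (moment k) ≠ 0 := by
  have e : det3 (moment i) (moment j) (moment k) =
      ((j : ℝ) - i) * ((k : ℝ) - i) * ((k : ℝ) - j) := by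
    rw [det3_coord]; simp [moment]; ring
  rw [e]
  have h1 : (i : ℝ) ≠ j := by exact_mod_cast hij
  have h2 : (j : ℝ) ≠ k := by exact_mod_cast hjk
  have h3 : (i : ℝ) ≠ k := by exact_mod_cast hik
  exact mul_ne_zero (mul_ne_zero (sub_ne_zero.2 h1.symm) (sub_ne_zero.2 h3.symm))
    (sub_ne_zero.2 h2.symm)

/-- The rotor holonomy of a simple closed polygon is `-1`. -/
theorem fanRotor_of_simple {v : ℕ → Space3} {m : ℕ} (hm : 2 ≤ m) (hper : v (m + 1) = v 0)
    (h0 : ∀ i, v i ≠ 0) (hrev0 : NoReversal (v 0) (v m) (v 1))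
    (hrev : ∀ i < m, NoReversal (v (i + 1)) (v i) (v (i + 2)))
    (hdisj : ∀ i j, i + 1 < j → j ≤ m → ¬(i = 0 ∧ j = m) →
      ArcsDisjoint (v i) (v (i + 1)) (v j) (v (j + 1))) :
    fanRotor v 1 (m - 1) = -1 := by
  -- The shift depends on i modulo m + 1, so that the perturbed polygon still closes up at index m +
  -- 1.
  let u : ℝ → ℕ → Space3 := fun e i => v i + e • moment (i % (m + 1))
  have hu0 : u 0 = v := by funext i; simp [u]
  have hmod : ∀ i ≤ m, i % (m + 1) = i := fun i hi => Nat.mod_eq_of_lt (by omega)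
  have hcont : ContinuousAt (fun e => fanRotor (u e) 1 (m - 1)) 0 := by
    apply continuousAt_fanRotor
    · intro i; simp only [u]; fun_prop
    · rwa [hu0]
    · rwa [hu0, show 1 + (m - 1) = m by omega]
    · intro i hi; rw [hu0]; exact hrev i (by omega)
  have hlim : Tendsto (fun e => fanRotor (u e) 1 (m - 1)) (𝓝[≠] 0)
      (𝓝 (fanRotor v 1 (m - 1))) := by
    have := hcont.tendsto
    rw [hu0] at this
    exact this.mono_left nhdsWithin_le_nhds
  have hgen : ∀ᶠ e in 𝓝[≠] (0 : ℝ), ∀ i ∈ Finset.range (m + 1), ∀ j ∈ Finset.range (m + 1),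
      ∀ k ∈ Finset.range (m + 1), i ≠ j → j ≠ k → i ≠ k →
        det3 (u e i) (u e j) (u e k) ≠ 0 := by
    simp only [Filter.eventually_all_finset]
    intro i hi j hj k hk
    simp only [Finset.mem_range] at hi hj hk
    by_cases hd : i ≠ j ∧ j ≠ k ∧ i ≠ k
    · filter_upwards [eventually_det3_ne_zero (v i) (v j) (v k)
        (det3_moment hd.1 hd.2.1 hd.2.2)] with e he _ _ _
      simpa only [u, hmod i (by omega), hmod j (by omega), hmod k (by omega)] using he
    · exact Eventually.of_forall fun e h1 h2 h3 => absurd ⟨h1, h2, h3⟩ hd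
  have hdis : ∀ᶠ e in 𝓝[≠] (0 : ℝ), ∀ i ∈ Finset.range (m + 1), ∀ j ∈ Finset.range (m + 1),
      i + 1 < j → ¬(i = 0 ∧ j = m) → ∀ x y z w : ℝ, 0 < x → 0 < y → 0 < z → 0 < w →
        x • u e i + y • u e (i + 1) ≠ z • u e j + w • u e (j + 1) := by
    simp only [Filter.eventually_all_finset]
    intro i hi j hj
    simp only [Finset.mem_range] at hi hj
    by_cases hd : i + 1 < j ∧ ¬(i = 0 ∧ j = m)
    · filter_upwards [nhdsWithin_le_nhds ((hdisj i j hd.1 (by omega) hd.2).eventually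
        (moment (i % (m + 1))) (moment ((i + 1) % (m + 1))) (moment (j % (m + 1)))
        (moment ((j + 1) % (m + 1))))] with e he _ _
      exact he
    · exact Eventually.of_forall fun e h1 h2 => absurd ⟨h1, h2⟩ hd
  -- For small e ≠ 0 the holonomy is constantly `-1`, hence so is its limit.
  refine tendsto_nhds_unique hlim (tendsto_const_nhds.congr' ?_)
  filter_upwards [hgen, hdis] with e hg hd
  symm
  have hg' : ∀ i j k, i ≤ m → j ≤ m → k ≤ m → i ≠ j → j ≠ k → i ≠ k →
      det3 (u e i) (u e j) (u e k) ≠ 0 := fun i j k hi hj hk =>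
    hg i (by simp; omega) j (by simp; omega) k (by simp; omega)
  have hper' : u e (m + 1) = u e 0 := by simp [u, hper]
  refine fanRotor_eq_neg_one hm hper' hg' fun i j hij hj hn => ?_
  by_contra hc
  rw [Bool.not_eq_false] at hc
  obtain ⟨x, y, z, w, hx, hy, hz, hw, heq⟩ : ∃ x y z w : ℝ, 0 < x ∧ 0 < y ∧ 0 < z ∧ 0 < w ∧
      x • u e i + y • u e (i + 1) = z • u e j + w • u e (j + 1) := by
    rcases hj.lt_or_eq with hj | rfl
    · exact crosses_geom hc
        (hg' _ _ _ (by omega) (by omega) (by omega) (by omega) (by omega) (by omega))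
        (hg' _ _ _ (by omega) (by omega) (by omega) (by omega) (by omega) (by omega))
        (hg' _ _ _ (by omega) (by omega) (by omega) (by omega) (by omega) (by omega))
        (hg' _ _ _ (by omega) (by omega) (by omega) (by omega) (by omega) (by omega))
    · rw [hper'] at hc ⊢
      exact crosses_geom hc
        (hg' _ _ _ (by omega) (by omega) (by omega) (by omega) (by omega) (by omega))
        (hg' _ _ _ (by omega) (by omega) (by omega) (by omega) (by omega) (by omega))
        (hg' _ _ _ (by omega) (by omega) (by omega) (by omega) (by omega) (by omega))
        (hg' _ _ _ (by omega) (by omega) (by omega) (by omega) (by omega) (by omega))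
  exact hd i (by simp; omega) j (by simp; omega) hij hn x y z w hx hy hz hw heq

/-! ### Great arcs, their turns and interior angles -/

/-- The normal of the great circle that carries an arc. -/
def arcNormal (e : GreatArc) : Space3 := cross3 e.start e.dir

theorem norm_arcNormal (e : GreatArc) : ‖arcNormal e‖ = 1 := by
  have h := norm_cross3_sq e.start e.dir
  rw [e.norm_start, e.norm_dir, e.inner_start_dir] at h
  rw [arcNormal]
  nlinarith [norm_nonneg (cross3 e.start e.dir)]

theorem inner_point_point (e : GreatArc) (s t : ℝ) :
    inner ℝ (e.point s) (e.point t) = cos (t - s) := by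
  simp only [GreatArc.point, inner_add_left, inner_add_right, real_inner_smul_left,
    real_inner_smul_right, real_inner_self_eq_norm_sq, e.norm_start, e.norm_dir, e.inner_start_dir,
    real_inner_comm e.start e.dir, cos_sub]
  ring

theorem norm_point (e : GreatArc) (s : ℝ) : ‖e.point s‖ = 1 := by
  have := inner_point_point e s s
  rw [real_inner_self_eq_norm_sq, sub_self, cos_zero] at this
  nlinarith [norm_nonneg (e.point s)]

theorem point_ne_zero (e : GreatArc) (s : ℝ) : e.point s ≠ 0 := by
  rw [← norm_ne_zero_iff, norm_point]; exact one_ne_zero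

@[simp] theorem point_zero (e : GreatArc) : e.point 0 = e.start := by simp [GreatArc.point]

theorem cross3_point_point (e : GreatArc) (s t : ℝ) :
    cross3 (e.point s) (e.point t) = sin (t - s) • arcNormal e := by
  rw [sin_sub]
  apply ext_coord <;> simp [GreatArc.point, arcNormal] <;> ring

theorem arc_point_point (e : GreatArc) {s t : ℝ} (h0 : s ≤ t) (h1 : t - s ≤ π) :
    arc (e.point s) (e.point t) = t - s := by
  rw [arc, InnerProductGeometry.angle, inner_point_point, norm_point, norm_point, mul_one, div_one,
    arccos_cos (by linarith) h1]

/-- The intermediate value theorem finds c with x sin (c - s) = y sin (t - c), which says that the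
combination has no component along the velocity at c. -/
theorem point_combination (e : GreatArc) {s t x y : ℝ} (hst : s < t) (hπ : t - s < π)
    (hx : 0 ≤ x) (hy : 0 ≤ y) (hxy : ¬(x = 0 ∧ y = 0)) :
    ∃ r : ℝ, 0 < r ∧ ∃ c, s ≤ c ∧ c ≤ t ∧ x • e.point s + y • e.point t = r • e.point c := by
  have hs : 0 < sin (t - s) := sin_pos_of_pos_of_lt_pi (by linarith) hπ
  have hcont : ContinuousOn (fun c => x * sin (c - s) - y * sin (t - c)) (Set.Icc s t) := by
    fun_prop
  obtain ⟨c, ⟨hc1, hc2⟩, hc⟩ := intermediate_value_Icc hst.le hcont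
    (show (0 : ℝ) ∈ Set.Icc _ _ by constructor <;> simp <;> positivity)
  simp only at hc
  set r := x * cos (c - s) + y * cos (t - c) with hr
  have e1 : y * sin (t - s) = r * sin (c - s) := by
    have : sin (t - s) = sin ((t - c) + (c - s)) := by congr 1; ring
    rw [this, sin_add, hr]
    linear_combination -cos (c - s) * hc
  have e2 : x * sin (t - s) = r * sin (t - c) := by
    have : sin (t - s) = sin ((t - c) + (c - s)) := by congr 1; ring
    rw [this, sin_add, hr]
    linear_combination cos (t - c) * hc
  have p1 : 0 ≤ sin (c - s) := sin_nonneg_of_nonneg_of_le_pi (by linarith) (by linarith)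
  have p2 : 0 ≤ sin (t - c) := sin_nonneg_of_nonneg_of_le_pi (by linarith) (by linarith)
  have hrpos : 0 < r := by
    by_contra hneg
    push Not at hneg
    apply hxy
    constructor
    · have : x * sin (t - s) ≤ 0 := by rw [e2]; exact mul_nonpos_of_nonpos_of_nonneg hneg p2
      nlinarith
    · have : y * sin (t - s) ≤ 0 := by rw [e1]; exact mul_nonpos_of_nonpos_of_nonneg hneg p1
      nlinarith
  refine ⟨r, hrpos, c, hc1, hc2, ?_⟩
  have c1 : x * cos s + y * cos t = r * cos c := by
    have h1 : cos s = cos (c - (c - s)) := by congr 1; ring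
    have h2 : cos t = cos (c + (t - c)) := by congr 1; ring
    rw [h1, h2, cos_sub, cos_add, hr]
    linear_combination sin c * hc
  have c2 : x * sin s + y * sin t = r * sin c := by
    have h1 : sin s = sin (c - (c - s)) := by congr 1; ring
    have h2 : sin t = sin (c + (t - c)) := by congr 1; ring
    rw [h1, h2, sin_sub, sin_add, hr]
    linear_combination -cos c * hc
  simp only [GreatArc.point]
  match_scalars
  · linear_combination c1
  · linear_combination c2

theorem turn_straight_value (e : GreatArc) (s h : ℝ) :
    (⟨-inner ℝ (cross3 (e.point s) (e.point (s - h))) (cross3 (e.point s) (e.point (s + h))),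
      -(‖e.point s‖ * det3 (e.point s) (e.point (s - h)) (e.point (s + h)))⟩ : ℂ) =
      ((sin h ^ 2 : ℝ) : ℂ) := by
  have h1 : s - h - s = -h := by ring
  have h2 : s + h - s = h := by ring
  have h3 : inner ℝ (e.point s) (arcNormal e) = (0 : ℝ) := by
    simp only [GreatArc.point, arcNormal, inner_coord, cross3_zero, cross3_one, cross3_two,
      PiLp.add_apply, PiLp.smul_apply, smul_eq_mul]
    ring
  apply Complex.ext
  · rw [cross3_point_point, cross3_point_point, h1, h2]
    simp only [real_inner_smul_left, real_inner_smul_right, real_inner_self_eq_norm_sq,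
      norm_arcNormal, sin_neg, Complex.ofReal_re]
    ring
  · simp only [det3, cross3_point_point, real_inner_smul_right, h3, Complex.ofReal_im]
    ring

theorem turn_straight (e : GreatArc) (s h : ℝ) :
    turn (e.point s) (e.point (s - h)) (e.point (s + h)) = 0 := by
  rw [turn, turn_straight_value, Complex.arg_ofReal_of_nonneg (by positivity)]

theorem noReversal_straight (e : GreatArc) (s : ℝ) {h : ℝ} (h0 : 0 < h) (h1 : h < π) :
    NoReversal (e.point s) (e.point (s - h)) (e.point (s + h)) := by
  have := sin_pos_of_pos_of_lt_pi h0 h1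
  rw [NoReversal, turn_straight_value, Complex.ofReal_mem_slitPlane]
  positivity

theorem toIcoMod_arg_of_nonneg {z : ℂ} (h : 0 ≤ z.arg) :
    toIcoMod two_pi_pos 0 z.arg = z.arg := by
  rw [toIcoMod_eq_self]
  exact ⟨h, by linarith [Complex.arg_le_pi z, pi_pos]⟩

theorem toIcoMod_arg_of_neg {z : ℂ} (h : z.arg < 0) :
    toIcoMod two_pi_pos 0 z.arg = z.arg + 2 * π := by
  rw [← toIcoMod_add_right, toIcoMod_eq_self]
  exact ⟨by linarith [Complex.neg_pi_lt_arg z, pi_pos], by linarith⟩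

/-- Reflection in the imaginary axis takes the angle t to π - t. For t in [0, 2π) this lies in (-π,
π], exactly the range of `Complex.arg`, so no correction by 2π is needed even for reflex angles. -/
theorem arg_neg_conj {z : ℂ} (hz : z ≠ 0) :
    Complex.arg ⟨-z.re, z.im⟩ = π - toIcoMod two_pi_pos 0 z.arg := by
  set t := toIcoMod two_pi_pos 0 z.arg with ht
  have hcs : cos t = cos z.arg ∧ sin t = sin z.arg := by
    rcases le_or_gt 0 z.arg with h | h
    · rw [ht, toIcoMod_arg_of_nonneg h]; exact ⟨rfl, rfl⟩
    · rw [ht, toIcoMod_arg_of_neg h, cos_add_two_pi, sin_add_two_pi]; exact ⟨rfl, rfl⟩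
  have hmem := toIcoMod_mem_Ico two_pi_pos 0 z.arg
  rw [← ht, zero_add] at hmem
  have e : (⟨-z.re, z.im⟩ : ℂ) = (‖z‖ : ℂ) *
      (Complex.cos ((π - t : ℝ) : ℂ) + Complex.sin ((π - t : ℝ) : ℂ) * Complex.I) := by
    rw [← Complex.ofReal_cos, ← Complex.ofReal_sin, cos_pi_sub, sin_pi_sub, hcs.1, hcs.2]
    have h1 := Complex.norm_mul_cos_arg z
    have h2 := Complex.norm_mul_sin_arg z
    apply Complex.ext
    · simp only [Complex.mul_re, Complex.add_re, Complex.ofReal_re, Complex.I_re,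
        Complex.ofReal_im, Complex.I_im, Complex.mul_im, Complex.add_im]
      linear_combination h1
    · simp only [Complex.mul_re, Complex.add_re, Complex.ofReal_re, Complex.I_re,
        Complex.ofReal_im, Complex.I_im, Complex.mul_im, Complex.add_im]
      linear_combination -h2
  rw [e, Complex.arg_mul_cos_add_sin_mul_I (norm_pos_iff.2 hz)]
  exact ⟨by linarith [hmem.2], by linarith [hmem.1]⟩

theorem ccwAngle_nonneg (p x y : Space3) : 0 ≤ ccwAngle p x y :=
  (toIcoMod_mem_Ico two_pi_pos 0 _).1

theorem ccwAngle_lt (p x y : Space3) : ccwAngle p x y < 2 * π := by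
  have := (toIcoMod_mem_Ico two_pi_pos 0
    (Complex.arg ⟨inner ℝ x y, inner ℝ p (cross3 x y)⟩)).2
  rwa [zero_add] at this

theorem ccwAngle_swap {p x y : Space3} (h : ccwAngle p x y ≠ 0) :
    ccwAngle p y x = 2 * π - ccwAngle p x y := by
  have e : (⟨inner ℝ y x, inner ℝ p (cross3 y x)⟩ : ℂ) =
      (starRingEnd ℂ) ⟨inner ℝ x y, inner ℝ p (cross3 x y)⟩ := by
    apply Complex.ext
    · simp [real_inner_comm]
    · have := det3_swap p x y
      simpa [det3] using this
  rw [ccwAngle] at h ⊢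
  rw [e, ccwAngle]
  set z : ℂ := ⟨inner ℝ x y, inner ℝ p (cross3 x y)⟩
  have hpi := pi_pos
  rcases lt_or_ge z.arg 0 with hz | hz
  · have : ((starRingEnd ℂ) z).arg = -z.arg := by
      rw [Complex.arg_conj, if_neg (by linarith)]
    rw [toIcoMod_arg_of_neg hz, toIcoMod_arg_of_nonneg (by linarith), this]; ring
  · rw [toIcoMod_arg_of_nonneg hz] at h ⊢
    by_cases hzp : z.arg = π
    · have : ((starRingEnd ℂ) z).arg = π := by rw [Complex.arg_conj, if_pos hzp]
      rw [toIcoMod_arg_of_nonneg (by linarith), this, hzp]; ring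
    · have : ((starRingEnd ℂ) z).arg = -z.arg := by rw [Complex.arg_conj, if_neg hzp]
      have hpos : 0 < z.arg := lt_of_le_of_ne hz (Ne.symm h)
      rw [toIcoMod_arg_of_neg (by linarith), this]; ring

theorem det3_sq (u x y : Space3) (hx : inner ℝ u x = (0 : ℝ)) (hy : inner ℝ u y = (0 : ℝ)) :
    det3 u x y ^ 2 = ‖u‖ ^ 2 * (‖x‖ ^ 2 * ‖y‖ ^ 2 - inner ℝ x y ^ 2) := by
  have key : det3 u x y ^ 2 = ‖u‖ ^ 2 * (‖x‖ ^ 2 * ‖y‖ ^ 2 - inner ℝ x y ^ 2) -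
      inner ℝ u x * (inner ℝ u x * ‖y‖ ^ 2 - inner ℝ x y * inner ℝ u y) +
      inner ℝ u y * (inner ℝ u x * inner ℝ x y - ‖x‖ ^ 2 * inner ℝ u y) := by
    simp only [det3_coord, norm_sq_coord, inner_coord]; ring
  rw [key, hx, hy]; ring

theorem norm_velocity (e : GreatArc) (s : ℝ) : ‖e.velocity s‖ = 1 := by
  have : inner ℝ (e.velocity s) (e.velocity s) = (1 : ℝ) := by
    have h1 : inner ℝ e.start e.start = (1 : ℝ) := by simp [e.norm_start]
    have h2 : inner ℝ e.dir e.dir = (1 : ℝ) := by simp [e.norm_dir]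
    simp only [GreatArc.velocity, inner_add_left, inner_add_right, real_inner_smul_left,
      real_inner_smul_right, h1, h2, e.inner_start_dir, real_inner_comm e.start e.dir]
    linear_combination sin_sq_add_cos_sq s
  rw [real_inner_self_eq_norm_sq] at this
  nlinarith [norm_nonneg (e.velocity s)]

theorem inner_point_velocity (e : GreatArc) (s : ℝ) :
    inner ℝ (e.point s) (e.velocity s) = (0 : ℝ) := by
  simp only [GreatArc.velocity, GreatArc.point, inner_add_left, inner_add_right,
    real_inner_smul_left, real_inner_smul_right, real_inner_self_eq_norm_sq, e.norm_start,
    e.norm_dir, e.inner_start_dir, real_inner_comm e.start e.dir]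
  ring

theorem point_sub (e : GreatArc) (s h : ℝ) :
    e.point (s - h) = cos h • e.point s - sin h • e.velocity s := by
  simp only [GreatArc.point, GreatArc.velocity, cos_sub, sin_sub]
  module

/-- The complex number whose argument is the angle from the outgoing arc `f` to the incoming
arc `e` at the vertex where they meet. -/
def vertexAngle (e f : GreatArc) : ℂ :=
  ⟨inner ℝ f.dir (-e.velocity e.length), inner ℝ f.start (cross3 f.dir (-e.velocity e.length))⟩

theorem norm_vertexAngle {e f : GreatArc} (h : e.point e.length = f.start) :
    ‖vertexAngle e f‖ = 1 := by
  have h1 : inner ℝ f.start (-e.velocity e.length) = (0 : ℝ) := by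
    rw [← h, inner_neg_right, inner_point_velocity, neg_zero]
  have h2 := det3_sq f.start f.dir _ f.inner_start_dir h1
  rw [norm_neg, f.norm_start, f.norm_dir, norm_velocity] at h2
  have h3 : ‖vertexAngle e f‖ ^ 2 = 1 := by
    rw [Complex.sq_norm, Complex.normSq_apply, vertexAngle]
    rw [det3] at h2
    linear_combination h2
  nlinarith [norm_nonneg (vertexAngle e f)]

/-- The chosen neighbours on the two arcs enter only through the factor sin s · sin t, so for
distances in (0, π) the turn depends on the tangent directions alone. -/
theorem turn_vertex_value {e f : GreatArc} (h : e.point e.length = f.start) (s t : ℝ) :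
    (⟨-inner ℝ (cross3 f.start (e.point (e.length - s))) (cross3 f.start (f.point t)),
      -(‖f.start‖ * det3 f.start (e.point (e.length - s)) (f.point t))⟩ : ℂ) =
      ((sin s * sin t : ℝ) : ℂ) * ⟨-(vertexAngle e f).re, (vertexAngle e f).im⟩ := by
  have hp := f.norm_start
  have h1 : inner ℝ f.start (e.velocity e.length) = (0 : ℝ) := by
    rw [← h, inner_point_velocity]
  have h2 := f.inner_start_dir
  have hp2 := norm_sq_coord f.start
  rw [hp] at hp2
  rw [point_sub, h]
  simp only [vertexAngle, GreatArc.point]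
  generalize e.velocity e.length = d at *
  rw [inner_coord] at h1 h2
  apply Complex.ext
  · rw [Complex.re_ofReal_mul]
    simp only [inner_coord, cross3_zero, cross3_one, cross3_two, PiLp.add_apply, PiLp.sub_apply,
      PiLp.smul_apply, PiLp.neg_apply, smul_eq_mul]
    linear_combination (-(sin s * sin t) *
      (d 0 * f.dir 0 + d 1 * f.dir 1 + d 2 * f.dir 2)) * hp2 -
      sin s * sin t * (f.start 0 * f.dir 0 + f.start 1 * f.dir 1 + f.start 2 * f.dir 2) * h1
  · rw [Complex.im_ofReal_mul, hp]
    simp only [det3_coord, inner_coord, cross3_zero, cross3_one, cross3_two, PiLp.add_apply,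
      PiLp.sub_apply, PiLp.smul_apply, PiLp.neg_apply, smul_eq_mul]
    ring

theorem turn_vertex {e f : GreatArc} (h : e.point e.length = f.start) {s t : ℝ} (hs : 0 < s)
    (hs' : s < π) (ht : 0 < t) (ht' : t < π) :
    turn f.start (e.point (e.length - s)) (f.point t) =
      π - ccwAngle f.start f.dir (-e.velocity e.length) := by
  have h1 := sin_pos_of_pos_of_lt_pi hs hs'
  have h2 := sin_pos_of_pos_of_lt_pi ht ht'
  rw [turn, turn_vertex_value h, Complex.arg_real_mul _ (mul_pos h1 h2), arg_neg_conj]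
  · rfl
  · rw [← norm_ne_zero_iff, norm_vertexAngle h]; exact one_ne_zero

theorem noReversal_vertex {e f : GreatArc} (h : e.point e.length = f.start) {s t : ℝ} (hs : 0 < s)
    (hs' : s < π) (ht : 0 < t) (ht' : t < π)
    (h0 : ccwAngle f.start f.dir (-e.velocity e.length) ≠ 0) :
    NoReversal f.start (e.point (e.length - s)) (f.point t) := by
  rw [NoReversal, Complex.mem_slitPlane_iff_arg]
  constructor
  · change turn _ _ _ ≠ π
    rw [turn_vertex h hs hs' ht ht']
    intro h1; apply h0; linarith
  · have h1 := sin_pos_of_pos_of_lt_pi hs hs'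
    have h2 := sin_pos_of_pos_of_lt_pi ht ht'
    rw [turn_vertex_value h]
    refine mul_ne_zero (by exact_mod_cast (mul_pos h1 h2).ne') fun h3 => ?_
    have h4 := norm_vertexAngle h
    have : vertexAngle e f = 0 := by
      apply Complex.ext
      · simpa using congrArg Complex.re h3
      · simpa using congrArg Complex.im h3
    rw [this] at h4; simp at h4

/-- If the angle at a vertex vanishes, the two arcs overlap there. -/
theorem point_eq_of_ccwAngle_eq_zero {e f : GreatArc} (h : e.point e.length = f.start)
    (h0 : ccwAngle f.start f.dir (-e.velocity e.length) = 0) (t : ℝ) :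
    e.point (e.length - t) = f.point t := by
  have harg : (vertexAngle e f).arg = 0 := by
    change toIcoMod two_pi_pos 0 (vertexAngle e f).arg = 0 at h0
    rcases lt_or_ge (vertexAngle e f).arg 0 with hz | hz
    · rw [toIcoMod_arg_of_neg hz] at h0
      linarith [Complex.neg_pi_lt_arg (vertexAngle e f), pi_pos]
    · rwa [toIcoMod_arg_of_nonneg hz] at h0
  have hre : inner ℝ f.dir (-e.velocity e.length) = (1 : ℝ) := by
    have := Complex.norm_mul_cos_arg (vertexAngle e f)
    rw [norm_vertexAngle h, harg, cos_zero] at this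
    simpa [vertexAngle] using this.symm
  have heq : f.dir = -e.velocity e.length :=
    (inner_eq_one_iff_of_norm_eq_one f.norm_dir (by rw [norm_neg, norm_velocity])).1 hre
  rw [point_sub, h, GreatArc.point, heq]
  module

/-! ### Subdividing the pentagon into short arcs -/

open scoped Fin.CommRing

/-- The points that divide every edge of a pentagon into three equal parts. -/
def trisection (P : SphericalPolygon 5) (n : ℕ) : Space3 :=
  (P.edge ((n / 3 : ℕ) : Fin 5)).point ((n % 3 : ℕ) * ((P.edge ((n / 3 : ℕ) : Fin 5)).length / 3))

theorem closed_cast (P : SphericalPolygon 5) (k : ℕ) :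
    (P.edge (k : Fin 5)).point (P.edge (k : Fin 5)).length = (P.edge ((k + 1 : ℕ) : Fin 5)).start := by
  rw [P.closed, Nat.cast_add, Nat.cast_one]

theorem trisection_eq (P : SphericalPolygon 5) (k : ℕ) {r : ℕ} (hr : r ≤ 3) :
    trisection P (3 * k + r) =
      (P.edge (k : Fin 5)).point (r * ((P.edge (k : Fin 5)).length / 3)) := by
  rcases hr.lt_or_eq with hr | rfl
  · rw [trisection, show (3 * k + r) / 3 = k by omega, show (3 * k + r) % 3 = r by omega]
  · rw [trisection, show (3 * k + 3) / 3 = k + 1 by omega, show (3 * k + 3) % 3 = 0 by omega]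
    rw [Nat.cast_zero, zero_mul, point_zero, ← closed_cast]
    congr 1; push_cast; ring

theorem trisection_mul_three (P : SphericalPolygon 5) (k : ℕ) :
    trisection P (3 * k) = (P.edge (k : Fin 5)).start := by
  have := trisection_eq P k (r := 0) (by omega)
  simpa using this

theorem length_div_three_pos (e : GreatArc) : 0 < e.length / 3 := by
  have := e.length_pos; positivity

/-- The purpose of the subdivision: an edge may exceed π, but each third is a minor arc, determined
by its endpoints and measured by `arc`. -/
theorem length_div_three_lt (e : GreatArc) : e.length / 3 < π := by
  linarith [e.length_lt, pi_pos]

theorem trisection_arc (P : SphericalPolygon 5) (k : ℕ) {r : ℕ} (hr : r < 3) :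
    arc (trisection P (3 * k + r)) (trisection P (3 * k + r + 1)) =
      (P.edge (k : Fin 5)).length / 3 := by
  have h0 := length_div_three_pos (P.edge (k : Fin 5))
  have h1 := length_div_three_lt (P.edge (k : Fin 5))
  rw [add_assoc, trisection_eq P k hr.le, trisection_eq P k (show r + 1 ≤ 3 by omega)]
  rw [arc_point_point] <;> push_cast <;> linarith

theorem trisection_straight (P : SphericalPolygon 5) (k : ℕ) {r : ℕ} (hr : r < 2) :
    ∃ s, trisection P (3 * k + r + 1) = (P.edge (k : Fin 5)).point s ∧
      trisection P (3 * k + r) =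
        (P.edge (k : Fin 5)).point (s - (P.edge (k : Fin 5)).length / 3) ∧
      trisection P (3 * k + r + 2) =
        (P.edge (k : Fin 5)).point (s + (P.edge (k : Fin 5)).length / 3) := by
  refine ⟨_, by rw [add_assoc, trisection_eq P k (show r + 1 ≤ 3 by omega)], ?_, ?_⟩
  · rw [trisection_eq P k (by omega)]; congr 1; push_cast; ring
  · rw [add_assoc, trisection_eq P k (by omega)]; congr 1; push_cast; ring

/-- The vertex `k + 1` of a pentagon, between two trisection points. -/
theorem trisection_vertex (P : SphericalPolygon 5) (k : ℕ) :
    trisection P (3 * k + 3) = (P.edge ((k + 1 : ℕ) : Fin 5)).start ∧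
      trisection P (3 * k + 2) = (P.edge (k : Fin 5)).point
        ((P.edge (k : Fin 5)).length - (P.edge (k : Fin 5)).length / 3) ∧
      trisection P (3 * k + 4) = (P.edge ((k + 1 : ℕ) : Fin 5)).point
        ((P.edge ((k + 1 : ℕ) : Fin 5)).length / 3) := by
  refine ⟨?_, ?_, ?_⟩
  · rw [show 3 * k + 3 = 3 * (k + 1) by ring, trisection_mul_three]
  · rw [trisection_eq P k (by omega)]; congr 1; push_cast; ring
  · rw [show 3 * k + 4 = 3 * (k + 1) + 1 by ring, trisection_eq P (k + 1) (by omega)]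
    congr 1; push_cast; ring

theorem interiorAngle_left_cast (P : SphericalPolygon 5) (k : ℕ) :
    P.interiorAngle .left ((k + 1 : ℕ) : Fin 5) =
      ccwAngle (P.edge ((k + 1 : ℕ) : Fin 5)).start (P.edge ((k + 1 : ℕ) : Fin 5)).dir
        (-(P.edge (k : Fin 5)).velocity (P.edge (k : Fin 5)).length) := by
  have : ((k + 1 : ℕ) : Fin 5) - 1 = (k : Fin 5) := by
    rw [Nat.cast_add, Nat.cast_one, add_sub_cancel_right]
  simp only [SphericalPolygon.interiorAngle, SphericalPolygon.dirNext, SphericalPolygon.dirPrev,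
    this]

theorem interiorAngle_left_ne_zero {P : SphericalPolygon 5} (hP : P.IsSimple) (k : ℕ) :
    P.interiorAngle .left ((k + 1 : ℕ) : Fin 5) ≠ 0 := by
  intro h0
  rw [interiorAngle_left_cast] at h0
  have h := point_eq_of_ccwAngle_eq_zero (closed_cast P k) h0
  set e := P.edge (k : Fin 5)
  set f := P.edge ((k + 1 : ℕ) : Fin 5)
  have he := e.length_pos
  have hf := f.length_pos
  -- A zero angle makes the two edges overlap near the vertex. Half the shorter length gives a
  -- common point strictly inside both.
  have h1 : 0 < min e.length f.length / 2 := by positivity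
  have h2 : min e.length f.length / 2 < e.length := by
    have := min_le_left e.length f.length; linarith
  have h3 : min e.length f.length / 2 < f.length := by
    have := min_le_right e.length f.length; linarith
  have h4 := (hP (k : Fin 5) ((k + 1 : ℕ) : Fin 5) _ ⟨by linarith, by linarith⟩ _ ⟨h1.le, h3⟩
    (h (min e.length f.length / 2))).1
  rw [Nat.cast_add, Nat.cast_one, left_eq_add] at h4
  exact absurd h4 (by decide)

theorem trisection_turn (P : SphericalPolygon 5) (k : ℕ) :
    turn (trisection P (3 * k + 3)) (trisection P (3 * k + 2)) (trisection P (3 * k + 4)) =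
      π - P.interiorAngle .left ((k + 1 : ℕ) : Fin 5) := by
  obtain ⟨h1, h2, h3⟩ := trisection_vertex P k
  rw [h1, h2, h3, turn_vertex (closed_cast P k) (length_div_three_pos _) (length_div_three_lt _)
    (length_div_three_pos _) (length_div_three_lt _), interiorAngle_left_cast]

theorem trisection_noReversal {P : SphericalPolygon 5} (hP : P.IsSimple) (n : ℕ) :
    NoReversal (trisection P (n + 1)) (trisection P n) (trisection P (n + 2)) := by
  obtain ⟨k, r, hr, rfl⟩ : ∃ k r, r < 3 ∧ n = 3 * k + r :=
    ⟨n / 3, n % 3, Nat.mod_lt _ (by norm_num), by omega⟩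
  rcases (show r < 2 ∨ r = 2 by omega) with hr | rfl
  · obtain ⟨s, h1, h2, h3⟩ := trisection_straight P k hr
    rw [h1, h2, h3]
    exact noReversal_straight _ _ (length_div_three_pos _) (length_div_three_lt _)
  · obtain ⟨h1, h2, h3⟩ := trisection_vertex P k
    have h0 := interiorAngle_left_ne_zero hP k
    rw [interiorAngle_left_cast] at h0
    change NoReversal (trisection P (3 * k + 3)) (trisection P (3 * k + 2))
      (trisection P (3 * k + 4))
    rw [h1, h2, h3]
    exact noReversal_vertex (closed_cast P k) (length_div_three_pos _) (length_div_three_lt _)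
      (length_div_three_pos _) (length_div_three_lt _) h0

theorem trisection_add_fifteen (P : SphericalPolygon 5) (n : ℕ) :
    trisection P (n + 15) = trisection P n := by
  have h : (((n + 15) / 3 : ℕ) : Fin 5) = ((n / 3 : ℕ) : Fin 5) := by
    rw [show (n + 15) / 3 = n / 3 + 5 by omega, Nat.cast_add]
    simp
  rw [trisection, trisection, h, show (n + 15) % 3 = n % 3 by omega]

/-- A point in the cone over a third of an edge, located on the half-open edges. -/
theorem trisection_combination (P : SphericalPolygon 5) {i : ℕ} (hi : i ≤ 14) {x y : ℝ}
    (hx : 0 ≤ x) (hy : 0 ≤ y) (hxy : ¬(x = 0 ∧ y = 0)) :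
    ∃ r : ℝ, 0 < r ∧ ∃ k < 5, ∃ s ∈ Set.Ico 0 (P.edge ((k : ℕ) : Fin 5)).length,
      x • trisection P i + y • trisection P (i + 1) = r • (P.edge (k : Fin 5)).point s ∧
      ((i ≤ 3 * k + s / ((P.edge (k : Fin 5)).length / 3) ∧
        3 * k + s / ((P.edge (k : Fin 5)).length / 3) ≤ i + 1) ∨ (i = 14 ∧ k = 0 ∧ s = 0)) := by
  obtain ⟨k, r, hr, rfl⟩ : ∃ k r, r < 3 ∧ i = 3 * k + r :=
    ⟨i / 3, i % 3, Nat.mod_lt _ (by norm_num), by omega⟩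
  set e := P.edge (k : Fin 5) with he
  have h0 := length_div_three_pos e
  have h1 := length_div_three_lt e
  have hr3 : (r : ℝ) + 1 ≤ 3 := by
    have : r + 1 ≤ 3 := by omega
    exact_mod_cast this
  obtain ⟨ρ, hρ, s, hs1, hs2, hs⟩ := point_combination e
    (s := r * (e.length / 3)) (t := ((r + 1 : ℕ) : ℝ) * (e.length / 3))
    (by push_cast; linarith) (by push_cast; linarith) hx hy hxy
  rw [← trisection_eq P k hr.le, ← trisection_eq P k (show r + 1 ≤ 3 by omega)] at hs
  push_cast at hs2
  have hs0 : 0 ≤ s := le_trans (by positivity) hs1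
  refine ⟨ρ, hρ, ?_⟩
  rcases lt_or_ge s e.length with hlt | hge
  · refine ⟨k, by omega, s, ⟨hs0, hlt⟩, hs, Or.inl ⟨?_, ?_⟩⟩
    · push_cast
      have := (le_div_iff₀ h0).2 hs1
      linarith
    · push_cast
      have := (div_le_iff₀ h0).2 hs2
      linarith
  -- The end of an edge is reached only in its last third, and is then relocated to the start of the
  -- next edge. After the last edge this is the start of edge 0, which accounts for the exceptional
  -- alternative.
  · have hr2 : r = 2 := by
      by_contra hne
      have : r + 1 ≤ 2 := by omega
      have : (r : ℝ) + 1 ≤ 2 := by exact_mod_cast this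
      nlinarith
    subst hr2
    have hse : s = e.length := le_antisymm (by push_cast at hs2; linarith) hge
    rw [hse, he, closed_cast] at hs
    rcases (show k < 4 ∨ k = 4 by omega) with hk | rfl
    · refine ⟨k + 1, by omega, 0, ⟨le_rfl, GreatArc.length_pos _⟩, by rw [point_zero]; exact hs,
        Or.inl ⟨?_, ?_⟩⟩ <;> push_cast <;> simp <;> linarith
    · refine ⟨0, by omega, 0, ⟨le_rfl, GreatArc.length_pos _⟩, by rw [point_zero]; exact hs,
        Or.inr ⟨by omega, rfl, rfl⟩⟩

/-- Measure position along the boundary in thirds of edges. By simplicity a common point has a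
single position, but the intervals [i, i + 1] and [j, j + 1] are disjoint. The first and the last
third meet at `trisection P 0`, hence their exclusion. -/
theorem trisection_disjoint {P : SphericalPolygon 5} (hP : P.IsSimple) {i j : ℕ} (hij : i + 1 < j)
    (hj : j ≤ 14) (h : ¬(i = 0 ∧ j = 14)) :
    ArcsDisjoint (trisection P i) (trisection P (i + 1)) (trisection P j)
      (trisection P (j + 1)) := by
  intro x y z w hx hy hz hw heq
  have norm_eq : ∀ (r : ℝ) (e : GreatArc) (s : ℝ), 0 < r → ‖r • e.point s‖ = r := fun r e s hr => by
    rw [norm_smul, norm_point, mul_one, Real.norm_of_nonneg hr.le]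
  by_cases hxy : x = 0 ∧ y = 0
  · by_cases hzw : z = 0 ∧ w = 0
    · exact ⟨hxy.1, hxy.2, hzw.1, hzw.2⟩
    · obtain ⟨r, hr, k, hk, s, hs, h1, -⟩ := trisection_combination P hj hz hw hzw
      rw [h1, hxy.1, hxy.2] at heq
      have := norm_eq r (P.edge (k : Fin 5)) s hr
      rw [← heq] at this
      simp at this
      exact absurd this hr.ne
  · by_cases hzw : z = 0 ∧ w = 0
    · obtain ⟨r, hr, k, hk, s, hs, h1, -⟩ :=
        trisection_combination P (show i ≤ 14 by omega) hx hy hxy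
      rw [h1, hzw.1, hzw.2] at heq
      have := norm_eq r (P.edge (k : Fin 5)) s hr
      rw [heq] at this
      simp at this
      exact absurd this hr.ne
    · exfalso
      obtain ⟨r, hr, k, hk, s, hs, h1, h2⟩ :=
        trisection_combination P (show i ≤ 14 by omega) hx hy hxy
      obtain ⟨r', hr', k', hk', s', hs', h1', h2'⟩ := trisection_combination P hj hz hw hzw
      rw [h1, h1'] at heq
      have hrr : r = r' := by
        rw [← norm_eq r _ s hr, heq, norm_eq r' _ s' hr']
      subst hrr
      obtain ⟨e1, rfl⟩ := hP _ _ s hs s' hs' (smul_right_injective _ hr.ne' heq)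
      have e2 : k = k' := by
        have := congrArg Fin.val e1
        rwa [Fin.val_natCast, Fin.val_natCast, Nat.mod_eq_of_lt hk, Nat.mod_eq_of_lt hk'] at this
      subst e2
      have hij' : (i : ℝ) + 1 < j := by exact_mod_cast hij
      rcases h2 with ⟨h2, h3⟩ | ⟨h2, -, -⟩
      · rcases h2' with ⟨h2', h3'⟩ | ⟨h2', h3', h4'⟩
        · linarith
        · rw [h3', h4'] at h2
          simp at h2
          exact h ⟨h2, h2'⟩
      · omega

theorem edgeRotor_third (l : ℝ) :
    edgeRotor l = edgeRotor (l / 3) * edgeRotor (l / 3) * edgeRotor (l / 3) := by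
  rw [← edgeRotor_add, ← edgeRotor_add]; congr 1; ring

set_option linter.unusedSimpArgs false in
/-- The rotor holonomy of a simple spherical pentagon. -/
theorem pentagon_rotor {P : SphericalPolygon 5} (hP : P.IsSimple) :
    turnRotor (π - P.interiorAngle .left 0) * edgeRotor (P.edgeLength 0) *
      turnRotor (π - P.interiorAngle .left 1) * edgeRotor (P.edgeLength 1) *
      turnRotor (π - P.interiorAngle .left 2) * edgeRotor (P.edgeLength 2) *
      turnRotor (π - P.interiorAngle .left 3) * edgeRotor (P.edgeLength 3) *
      turnRotor (π - P.interiorAngle .left 4) * edgeRotor (P.edgeLength 4) = -1 := by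
  have hper : trisection P 15 = trisection P 0 := trisection_add_fifteen P 0
  have hper' : trisection P 16 = trisection P 1 := trisection_add_fifteen P 1
  have h := fanRotor_of_simple (v := trisection P) (m := 14) (by norm_num) hper
    (fun i => point_ne_zero _ _)
    (by rw [← hper, ← hper']; exact trisection_noReversal hP 14)
    (fun i _ => trisection_noReversal hP i) (fun i j h1 h2 h3 => trisection_disjoint hP h1 h2 h3)
  have ha : ∀ k r, r < 3 → arc (trisection P (3 * k + r)) (trisection P (3 * k + r + 1)) =
      (P.edge (k : Fin 5)).length / 3 := fun k r hr => trisection_arc P k hr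
  have ht : ∀ k r, r < 2 → turn (trisection P (3 * k + r + 1)) (trisection P (3 * k + r))
      (trisection P (3 * k + r + 2)) = 0 := fun k r hr => by
    obtain ⟨s, h1, h2, h3⟩ := trisection_straight P k hr
    rw [h1, h2, h3, turn_straight]
  have hv := trisection_turn P
  have hv4 := hv 4
  simp only [Nat.reduceMul, Nat.reduceAdd, hper, hper'] at hv4
  simp only [fanRotor, chainRotor, Nat.reduceAdd, Nat.reduceSub, hper] at h
  have a0 := ha 0 0 (by norm_num); have a1 := ha 0 1 (by norm_num); have a2 := ha 0 2 (by norm_num)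
  have a3 := ha 1 0 (by norm_num); have a4 := ha 1 1 (by norm_num); have a5 := ha 1 2 (by norm_num)
  have a6 := ha 2 0 (by norm_num); have a7 := ha 2 1 (by norm_num); have a8 := ha 2 2 (by norm_num)
  have a9 := ha 3 0 (by norm_num); have b0 := ha 3 1 (by norm_num); have b1 := ha 3 2 (by norm_num)
  have b2 := ha 4 0 (by norm_num); have b3 := ha 4 1 (by norm_num); have b4 := ha 4 2 (by norm_num)
  have t0 := ht 0 0 (by norm_num); have t1 := ht 0 1 (by norm_num)
  have t2 := ht 1 0 (by norm_num); have t3 := ht 1 1 (by norm_num)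
  have t4 := ht 2 0 (by norm_num); have t5 := ht 2 1 (by norm_num)
  have t6 := ht 3 0 (by norm_num); have t7 := ht 3 1 (by norm_num)
  have t8 := ht 4 0 (by norm_num); have t9 := ht 4 1 (by norm_num)
  have v0 := hv 0; have v1 := hv 1; have v2 := hv 2; have v3 := hv 3
  simp only [Nat.reduceMul, Nat.reduceAdd, zero_add, mul_zero, add_zero, hper] at a0 a1 a2
  simp only [Nat.reduceMul, Nat.reduceAdd, zero_add, mul_zero, add_zero, hper] at a3 a4 a5 a6 a7
  simp only [Nat.reduceMul, Nat.reduceAdd, zero_add, mul_zero, add_zero, hper] at a8 a9 b0 b1 b2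
  simp only [Nat.reduceMul, Nat.reduceAdd, zero_add, mul_zero, add_zero, hper] at b3 b4 t0 t1 t2
  simp only [Nat.reduceMul, Nat.reduceAdd, zero_add, mul_zero, add_zero, hper] at t3 t4 t5 t6 t7
  simp only [Nat.reduceMul, Nat.reduceAdd, zero_add, mul_zero, add_zero, hper] at t8 t9 v0 v1 v2 v3
  rw [a0, a1, a2, a3, a4, a5, a6, a7, a8, a9, b0, b1, b2, b3, b4, t0, t1, t2, t3, t4, t5, t6, t7,
    t8, t9, v0, v1, v2, v3, hv4] at h
  simp only [turnRotor_zero, mul_one] at h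
  simp only [SphericalPolygon.edgeLength]
  rw [edgeRotor_third (P.edge 0).length, edgeRotor_third (P.edge 1).length,
    edgeRotor_third (P.edge 2).length, edgeRotor_third (P.edge 3).length,
    edgeRotor_third (P.edge 4).length]
  simp only [Nat.cast_ofNat, Nat.cast_zero, Nat.cast_one] at h
  simp only [mul_assoc] at h ⊢
  exact h

/-! ### Signs in the pentagon identity and comparison of angles -/

/-- In a simple pentagon, two edges of equal length that meet at a vertex are shorter than `π`. -/
theorem length_lt_pi {P : SphericalPolygon 5} (hP : P.IsSimple)
    (h : P.edgeLength 0 = P.edgeLength 4) : P.edgeLength 0 < π := by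
  by_contra hge
  push Not at hge
  simp only [SphericalPolygon.edgeLength] at h hge
  have hpi := pi_pos
  -- Great arcs of length at least π that start or end at A all pass through the antipode of A, so
  -- the two edges at A would meet there.
  have h0 : (P.edge 0).point π = -(P.edge 0).start := by simp [GreatArc.point]
  have h4 : (P.edge 4).point ((P.edge 4).length - π) = -(P.edge 0).start := by
    have : (P.edge 4).point ((P.edge 4).length - π) = -(P.edge 4).point (P.edge 4).length := by
      simp only [GreatArc.point, cos_sub_pi, sin_sub_pi]; module
    rw [this, P.closed]; rfl
  have m4 : (P.edge 4).length - π ∈ Set.Ico 0 (P.edge 4).length :=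
    ⟨by linarith, by linarith⟩
  rcases hge.lt_or_eq with hlt | heq
  · have := (hP 0 4 π ⟨hpi.le, hlt⟩ _ m4 (h0.trans h4.symm)).1
    exact absurd this (by decide)
  -- At length exactly π the antipode is the end of edge 0, outside its half-open range, and counts
  -- as the start of edge 1.
  · have e1 : (P.edge 1).point 0 = -(P.edge 0).start := by
      rw [point_zero, ← h0, heq, P.closed]; rfl
    have := (hP 1 4 0 ⟨le_rfl, GreatArc.length_pos _⟩ _ m4 (e1.trans h4.symm)).1
    exact absurd this (by decide)

theorem sin_half_neg_iff {x y : ℝ} (hx : 0 ≤ x) (hx' : x < 2 * π) (hy : 0 ≤ y) (hy' : y < 2 * π) :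
    sin ((x - y) / 2) < 0 ↔ x < y := by
  constructor
  · intro h
    by_contra hle
    push Not at hle
    exact absurd (sin_nonneg_of_nonneg_of_le_pi (by linarith) (by linarith)) (not_le.2 h)
  · intro h
    exact sin_neg_of_neg_of_neg_pi_lt (by linarith) (by linarith)

/-- All factors of `pentagon_identity` other than the sines of half differences are positive, so
those two sines share their sign. Both strict versions are recorded because passing to the right
side reverses the inequalities. -/
theorem interiorAngle_left_comparison {P : SphericalPolygon 5} (hP : P.IsSimple)
    (h1 : P.edgeLength 0 = P.edgeLength 4) (h2 : P.edgeLength 1 = P.edgeLength 3) :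
    (P.interiorAngle .left 4 < P.interiorAngle .left 1 ↔
      P.interiorAngle .left 2 < P.interiorAngle .left 3) ∧
    (P.interiorAngle .left 1 < P.interiorAngle .left 4 ↔
      P.interiorAngle .left 3 < P.interiorAngle .left 2) := by
  have hrot := pentagon_rotor hP
  rw [← h1, ← h2] at hrot
  have key := pentagon_identity hrot
  have hn : ∀ i, 0 ≤ P.interiorAngle .left i := fun i => ccwAngle_nonneg _ _ _
  have hl : ∀ i, P.interiorAngle .left i < 2 * π := fun i => ccwAngle_lt _ _ _
  have h0 : P.interiorAngle .left 0 ≠ 0 := interiorAngle_left_ne_zero hP 4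
  have hb : 0 < sin (P.edgeLength 0) :=
    sin_pos_of_pos_of_lt_pi (GreatArc.length_pos _) (length_lt_pi hP h1)
  have hc : 0 < sin (P.edgeLength 2 / 2) := by
    have p1 : 0 < P.edgeLength 2 := GreatArc.length_pos _
    have p2 : P.edgeLength 2 < 2 * π := GreatArc.length_lt _
    exact sin_pos_of_pos_of_lt_pi (by linarith) (by linarith)
  have ha : 0 < cos ((π - P.interiorAngle .left 0) / 2) := by
    have := lt_of_le_of_ne (hn 0) h0.symm
    exact cos_pos_of_mem_Ioo ⟨by linarith [hl 0], by linarith⟩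
  rw [show (π - P.interiorAngle .left 1 - (π - P.interiorAngle .left 4)) / 2 =
      (P.interiorAngle .left 4 - P.interiorAngle .left 1) / 2 by ring,
    show (π - P.interiorAngle .left 3 - (π - P.interiorAngle .left 2)) / 2 =
      (P.interiorAngle .left 2 - P.interiorAngle .left 3) / 2 by ring] at key
  have hba := mul_pos hb ha
  have neg : ∀ {a x : ℝ}, 0 < a → (a * x < 0 ↔ x < 0) := fun {a x} ha => by
    constructor
    · intro h; by_contra hx; push Not at hx; exact absurd (mul_nonneg ha.le hx) (not_le.2 h)
    · exact mul_neg_of_pos_of_neg ha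
  have flip : ∀ x y : ℝ, sin ((x - y) / 2) = -sin ((y - x) / 2) := fun x y => by
    rw [← sin_neg]; congr 1; ring
  constructor
  · rw [← sin_half_neg_iff (hn 4) (hl 4) (hn 1) (hl 1), ← neg hba, key, neg hc,
      sin_half_neg_iff (hn 2) (hl 2) (hn 3) (hl 3)]
  · rw [flip (P.interiorAngle .left 4), flip (P.interiorAngle .left 2), mul_neg, mul_neg,
      neg_inj] at key
    rw [← sin_half_neg_iff (hn 1) (hl 1) (hn 4) (hl 4), ← neg hba, key, neg hc,
      sin_half_neg_iff (hn 3) (hl 3) (hn 2) (hl 2)]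

theorem interiorAngle_right {P : SphericalPolygon 5} (hP : P.IsSimple) (k : ℕ) :
    P.interiorAngle .right ((k + 1 : ℕ) : Fin 5) =
      2 * π - P.interiorAngle .left ((k + 1 : ℕ) : Fin 5) :=
  ccwAngle_swap (interiorAngle_left_ne_zero hP k)

end SphereRotor

end

theorem mainTheorem3 (P : SphericalPolygon 5) (hP : P.IsSimple) (side : Side) (a b : ℝ)
    (hAB : P.edgeLength 0 = b) (hBD : P.edgeLength 1 = a)
    (hEC : P.edgeLength 3 = a) (hCA : P.edgeLength 4 = b) :
    P.interiorAngle side 1 > P.interiorAngle side 4 ↔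
      P.interiorAngle side 2 < P.interiorAngle side 3 := by
  have h := SphereRotor.interiorAngle_left_comparison hP (hAB.trans hCA.symm) (hBD.trans hEC.symm)
  cases side with
  | left => exact h.1
  | right =>
    -- Complements to 2π reverse both inequalities, which leaves the second half of the comparison
    -- on the left.
    have h1 : P.interiorAngle .right 1 = 2 * Real.pi - P.interiorAngle .left 1 :=
      SphereRotor.interiorAngle_right hP 0
    have h2 : P.interiorAngle .right 2 = 2 * Real.pi - P.interiorAngle .left 2 :=
      SphereRotor.interiorAngle_right hP 1
    have h3 : P.interiorAngle .right 3 = 2 * Real.pi - P.interiorAngle .left 3 :=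
      SphereRotor.interiorAngle_right hP 2
    have h4 : P.interiorAngle .right 4 = 2 * Real.pi - P.interiorAngle .left 4 :=
      SphereRotor.interiorAngle_right hP 3
    rw [h1, h2, h3, h4, gt_iff_lt, sub_lt_sub_iff_left, sub_lt_sub_iff_left]
    exact h.2
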